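/- Conventions. All hypergraphs are finite, with edges being sets of vertices; a hypergraph is $r$-uniform if every edge has exactly $r$ vertices. A supertree is a hypergraph with at least one vertex that is connected and has no cycle, a cycle being a cyclic sequence $v_1,e_1,v_2,e_2,\dots,v_m,e_m,v_1$ with $m\ge 2$, distinct vertices $v_i$ and distinct edges $e_i$ such that $v_i,v_{i+1}\in e_i$ (indices modulo $m$). For an $r$-uniform hypergraph $\mathcal H$ with $n$ vertices let $m(\mathcal H,k)$ be the number of sets of $k$ pairwise disjoint edges. The matching polynomial of $\mathcal H$ is $$\varphi(\mathcal H,x)=\sum_{k\ge 0}(-1)^k\,m(\mathcal H,k)\,x^{\,n-kr},$$ and the matching energy $ME(\mathcal H)$ is the sum of the absolute values of the complex roots of $\varphi(\mathcal H,x)$, counted with multiplicity. The adjacency tensor of $\mathcal H$ is the tensor of order $r$ indexed by the vertices with entries $a_{i_1\cdots i_r}=\frac{1}{(r-1)!}$ if $\{i_1,\dots,i_r\}\in E(\mathcal H)$ and $a_{i_1\cdots i_r}=0$ otherwise. A number $\lambda\in\mathbb C$ is an eigenvalue of it if there is a nonzero complex vector $x$ with $$\sum_{i_2,\dots,i_r}a_{i\,i_2\cdots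 i_r}\,x_{i_2}\cdots x_{i_r}=\lambda\, x_i^{\,r-1}\quad\text{for every vertex } i,$$ and the spectral radius $\rho(\mathcal H)$ is the largest modulus of an eigenvalue. $\mathcal H-v$ denotes the hypergraph obtained from $\mathcal H$ by deleting the vertex $v$ and all edges containing $v$. $\mathcal G(u,w)\Gamma$ denotes the hypergraph obtained from disjoint copies of $\mathcal G$ and $\Gamma$ by identifying $u\in V(\mathcal G)$ with $w\in V(\Gamma)$. Theorem. Let $r\ge 3$ and let $\mathcal G,\mathcal H,\Gamma$ be $r$-uniform supertrees, where $\mathcal G$ and $\mathcal H$ have the same number of vertices. Let $u\in V(\mathcal G)$ and $v\in V(\mathcal H)$. If $\varphi(\mathcal G,x)=\varphi(\mathcal H,x)$ and $\varphi(\mathcal G-u,x)=\varphi(\mathcal H-v,x)$, then for every $w\in V(\Gamma)$ the hypergraphs $\mathcal G(u,w)\Gamma$ and $\mathcal H(v,w)\Gamma$ are $r$-uniform supertrees, and $$\rho(\mathcal G(u,w)\Gamma)=\rho(\mathcal H(v,w)\Gamma)\quad\text{and}\quad ME(\mathcal G(u,w)\Gamma)=ME(\mathcal H(v,w)\Gamma).$$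 -/

import Mathlib

open scoped Hypergraph

/-- Real tensors of order `r` whose indices range over `ι`. The first index is separated from the
remaining `r - 1` ones: `A i f` is the entry `a_{i i₂ … i_r}`, where `f` lists `i₂, …, i_r`. -/
abbrev Tensor (r : ℕ) (ι : Type*) := ι → (Fin (r - 1) → ι) → ℝ

namespace Tensor

variable {r : ℕ} {ι : Type*}

/-- The vector `A x`, with `(A x)_i = ∑_{i₂, …, i_r} a_{i i₂ … i_r} x_{i₂} ⋯ x_{i_r}`. The index
type is finite in all uses, so that the `finsum` is an ordinary finite sum. -/
noncomputable def apply (A : Tensor r ι) (x : ι → ℂ) (i : ι) : ℂ :=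
  ∑ᶠ f : Fin (r - 1) → ι, (A i f : ℂ) * ∏ j, x (f j)

/-- `c` is an eigenvalue of `A`: there is a nonzero complex vector `x` with `A x = c x^{[r-1]}`. -/
def IsEigenvalue (A : Tensor r ι) (c : ℂ) : Prop :=
  ∃ x : ι → ℂ, x ≠ 0 ∧ ∀ i, A.apply x i = c * x i ^ (r - 1)

/-- The spectral radius: the largest modulus of an eigenvalue. -/
noncomputable def spectralRadius (A : Tensor r ι) : ℝ :=
  sSup {t : ℝ | ∃ c : ℂ, A.IsEigenvalue c ∧ t = ‖c‖}

end Tensor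

namespace Hypergraph

variable {α β : Type*}

/-- Every edge has exactly `r` vertices. -/
def IsUniform (H : Hypergraph α) (r : ℕ) : Prop := ∀ e ∈ E(H), e.encard = r

/-- Nonempty, and any two vertices are joined by a chain of successively adjacent vertices. -/
def IsConnected (H : Hypergraph α) : Prop :=
  V(H).Nonempty ∧ ∀ x ∈ V(H), ∀ y ∈ V(H), Relation.ReflTransGen H.Adj x y

/-- There is no (Berge) cycle, that is, no cyclic sequence `v₀ e₀ v₁ e₁ … v_{m-1} e_{m-1} v₀` of
length `m = l + 2 ≥ 2` with distinct vertices and distinct edges such that `e_i` contains `v_i`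
and `v_{i+1}`. Here `i + 1` is taken in `Fin (l + 2)`, so modulo `l + 2`. -/
def IsAcyclic (H : Hypergraph α) : Prop :=
  ¬ ∃ (l : ℕ) (v : Fin (l + 2) → α) (e : Fin (l + 2) → Set α),
    v.Injective ∧ e.Injective ∧ ∀ i, e i ∈ E(H) ∧ v i ∈ e i ∧ v (i + 1) ∈ e i

/-- A finite, connected, acyclic hypergraph. -/
structure IsSupertree (H : Hypergraph α) : Prop where
  finite : V(H).Finite
  connected : H.IsConnected
  acyclic : H.IsAcyclic

/-- `H - v`: delete the vertex `v` and all edges incident with it. -/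
def deleteVertex (H : Hypergraph α) (v : α) : Hypergraph α where
  vertexSet := V(H) \ {v}
  edgeSet := {e ∈ E(H) | v ∉ e}
  subset_vertexSet_of_mem_edgeSet' := fun _ he _ hx =>
    ⟨H.subset_vertexSet_of_mem_edgeSet he.1 hx, fun h => he.2 (h ▸ hx)⟩

open Classical in
/-- The embedding of the second vertex set in the coalescence: `w` goes to the point `u` of the
first hypergraph, every other point goes to its own copy. -/
noncomputable def glueMap (u : α) (w : β) (y : β) : α ⊕ β := if y = w then .inl u else .inr y

/-- `G(u,w)K`: the hypergraph obtained from disjoint copies of `G` and `K` by identifying the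
vertex `u` of `G` with the vertex `w` of `K`. The identified vertex is represented by `inl u`. -/
noncomputable def glue (G : Hypergraph α) (u : α) (K : Hypergraph β) (w : β) :
    Hypergraph (α ⊕ β) where
  vertexSet := V(G.image Sum.inl) ∪ V(K.image (glueMap u w))
  edgeSet := E(G.image Sum.inl) ∪ E(K.image (glueMap u w))
  subset_vertexSet_of_mem_edgeSet' := fun _ he => he.elim
    (fun h => (subset_vertexSet_of_mem_edgeSet h).trans Set.subset_union_left)
    (fun h => (subset_vertexSet_of_mem_edgeSet h).trans Set.subset_union_right)

/-- `m(H, k)`: the number of sets of `k` pairwise disjoint edges. -/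
noncomputable def matchingCount (H : Hypergraph α) (k : ℕ) : ℕ :=
  {M : Finset (Set α) | (M : Set (Set α)) ⊆ E(H) ∧
    (M : Set (Set α)).PairwiseDisjoint id ∧ M.card = k}.ncard

open Polynomial in
/-- The matching polynomial `∑_{k ≥ 0} (-1)^k m(H, k) x^(n - k r)` of an `r`-uniform hypergraph
with `n` vertices, `r ≥ 1`. As `m(H, k) = 0` for `k r > n`, the sum stops at `k = n`, and the
truncation of `n - k * r` at `0` affects only terms with coefficient `0`. -/
noncomputable def matchingPoly (H : Hypergraph α) (r : ℕ) : ℤ[X] :=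
  ∑ k ∈ Finset.range (V(H).ncard + 1),
    C ((-1) ^ k * (H.matchingCount k : ℤ)) * X ^ (V(H).ncard - k * r)

/-- The matching energy: the sum of the absolute values of the complex roots of the matching
polynomial, counted with multiplicity. -/
noncomputable def matchingEnergy (H : Hypergraph α) (r : ℕ) : ℝ :=
  (((H.matchingPoly r).aroots ℂ).map (‖·‖)).sum

open Classical in
/-- The adjacency tensor: the entry at `i₁, …, i_r` is `1 / (r-1)!` if `{i₁, …, i_r}` is an edge,
and `0` otherwise. -/
noncomputable def adjacencyTensor (H : Hypergraph α) (r : ℕ) : Tensor r V(H) := fun i f =>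
  if insert (i : α) (Set.range fun j => (f j : α)) ∈ E(H) then 1 / ((r - 1).factorial : ℝ) else 0

/-- The spectral radius of an `r`-uniform hypergraph: that of its adjacency tensor. -/
noncomputable def spectralRadius (H : Hypergraph α) (r : ℕ) : ℝ :=
  (H.adjacencyTensor r).spectralRadius

/-- The supremum that defines the spectral radius is a maximum. -/
theorem isGreatest_spectralRadius (H : Hypergraph α) {r : ℕ} (hr : 3 ≤ r) (hf : V(H).Finite)
    (hne : V(H).Nonempty) (hu : H.IsUniform r) :
    IsGreatest {t : ℝ | ∃ c : ℂ, (H.adjacencyTensor r).IsEigenvalue c ∧ t = ‖c‖}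
      (H.spectralRadius r) := by
  have : Finite V(H) := hf
  have : Nonempty V(H) := hne.to_subtype
  have := Fintype.ofFinite V(H)
  classical
  set A := H.adjacencyTensor r with hA
  have happ : ∀ x i, A.apply x i = ∑ f : Fin (r - 1) → V(H), (A i f : ℂ) * ∏ j, x (f j) :=
    fun x i => finsum_eq_sum_of_fintype _
  set C : ℝ := ∑ i, ∑ f, |A i f| with hC
  let S : Set (ℂ × (V(H) → ℂ)) :=
    (Metric.closedBall 0 C ×ˢ Metric.sphere 0 1) ∩ {p | ∀ i, A.apply p.2 i = p.1 * p.2 i ^ (r - 1)}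
  have hS : IsCompact S := by
    refine ((isCompact_closedBall _ _).prod (isCompact_sphere _ _)).inter_right ?_
    simp only [happ, Set.ofPred_forall]
    refine isClosed_iInter fun i => isClosed_eq ?_ ?_ <;> fun_prop
  have himg : {t : ℝ | ∃ c : ℂ, A.IsEigenvalue c ∧ t = ‖c‖} = (fun p => ‖p.1‖) '' S := by
    ext t
    constructor
    · rintro ⟨c, ⟨x, hx, h⟩, rfl⟩
      have hx0 : ‖x‖ ≠ 0 := norm_ne_zero_iff.2 hx
      set y : V(H) → ℂ := (‖x‖⁻¹ : ℂ) • x with hy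
      have hyn : ‖y‖ = 1 := by
        rw [hy, norm_smul, norm_inv, Complex.norm_real, norm_norm, inv_mul_cancel₀ hx0]
      have hye : ∀ i, A.apply y i = c * y i ^ (r - 1) := by
        intro i
        have h1 : A.apply y i = (‖x‖⁻¹ : ℂ) ^ (r - 1) * A.apply x i := by
          rw [happ, happ, Finset.mul_sum]
          refine Finset.sum_congr rfl fun f _ => ?_
          simp only [hy, Pi.smul_apply, smul_eq_mul, Finset.prod_mul_distrib, Finset.prod_const,
            Finset.card_univ, Fintype.card_fin]
          ring
        rw [h1, h i, hy, Pi.smul_apply, smul_eq_mul, mul_pow]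
        ring
      refine ⟨(c, y), ⟨⟨?_, by simpa using hyn⟩, hye⟩, rfl⟩
      rw [mem_closedBall_zero_iff]
      obtain ⟨i, hi⟩ : ∃ i, ‖y i‖ = 1 := by
        obtain ⟨i, -, hi⟩ := Finset.exists_max_image Finset.univ (fun i => ‖y i‖)
          Finset.univ_nonempty
        refine ⟨i, le_antisymm (hyn ▸ norm_le_pi_norm y i) ?_⟩
        rw [← hyn]
        exact (pi_norm_le_iff_of_nonneg (norm_nonneg _)).2 fun j => hi j (Finset.mem_univ j)
      calc ‖c‖ = ‖A.apply y i‖ := by rw [hye i, norm_mul, norm_pow, hi, one_pow, mul_one]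
        _ ≤ ∑ f, |A i f| := by
          rw [happ]
          refine (norm_sum_le _ _).trans (Finset.sum_le_sum fun f _ => ?_)
          rw [norm_mul, Complex.norm_real, Real.norm_eq_abs, norm_prod]
          refine mul_le_of_le_one_right (abs_nonneg _) ?_
          exact Finset.prod_le_one (fun _ _ => norm_nonneg _)
            fun j _ => hyn ▸ norm_le_pi_norm y (f j)
        _ ≤ C := Finset.single_le_sum (f := fun i => ∑ f, |A i f|)
          (fun i _ => Finset.sum_nonneg fun _ _ => abs_nonneg _) (Finset.mem_univ i)
    · rintro ⟨⟨c, x⟩, ⟨⟨-, hx⟩, h⟩, rfl⟩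
      refine ⟨c, ⟨x, ?_, h⟩, rfl⟩
      rintro rfl
      simp at hx
  have hnon : {t : ℝ | ∃ c : ℂ, A.IsEigenvalue c ∧ t = ‖c‖}.Nonempty := by
    obtain ⟨a⟩ := ‹Nonempty V(H)›
    refine ⟨_, 0, ⟨Pi.single a 1, by simp, fun i => ?_⟩, rfl⟩
    rw [happ, zero_mul]
    refine Finset.sum_eq_zero fun f _ => ?_
    by_cases hfa : ∀ j, f j = a
    · have : A i f = 0 := by
        rw [hA, adjacencyTensor, if_neg]
        intro he
        have h2 : (insert (i : α) (Set.range fun j => (f j : α))).encard ≤ 2 :=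
          (Set.encard_le_encard (t := {(i : α), (a : α)}) (Set.insert_subset_insert
            (by rintro _ ⟨j, rfl⟩; simp [hfa j]))).trans 
            ((Set.encard_insert_le _ _).trans (by rw [Set.encard_singleton]; norm_num))
        rw [hu _ he] at h2
        have : r ≤ 2 := by exact_mod_cast h2
        omega
      simp [this]
    · push Not at hfa
      obtain ⟨j, hj⟩ := hfa
      rw [Finset.prod_eq_zero (Finset.mem_univ j) (by simp [hj]), mul_zero]
  rw [himg] at hnon
  obtain ⟨t, ht⟩ := (hS.image (f := fun p => ‖p.1‖) (by fun_prop)).exists_isGreatest hnon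
  rw [← himg] at ht
  rwa [spectralRadius, Tensor.spectralRadius, ht.csSup_eq]

end Hypergraph

/-! The matching polynomial controls both invariants. The matching energy is read off from its
roots, and for a uniform supertree the spectral radius is its largest real root
(`IsSupertree.isGreatest_roots`). So it suffices that the two coalescences have the same matching
polynomial.

A matching of the coalescence is a pair of matchings, one in each part, that do not both cover the
glued vertex. Hence its matching numbers depend on the first part only through those of the
hypergraph and of its vertex deletion (`matchingGen_glue`), and these are coefficients of the two
given polynomials.

For the root statement, take a positive vector with `c * x i ^ r` equal to the sum of the edge
products at `i`; here `c` is the spectral radius. Inclusion-exclusion writes the matching polynomial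
at `t`, times a positive number, as a sum over assignments of an incident edge or nothing to each
vertex such that no edge is chosen by all its vertices; choosing nothing at `v` costs `(t - c) * x v
^ r`. For `t > c` the sum is positive. At `t = c` every vertex must choose an edge and every edge is
chosen at most `r - 1` times, impossible when `(r - 1) * |E| < |V|`. Among finite connected uniform
hypergraphs this inequality also forces acyclicity, which makes the coalescence a supertree. -/

/-! ### Berge cycles and the count of edges against vertices. -/

/-- A sequence without repetitions at distance less than `l + 2` is injective on windows of that
length. -/
theorem injective_window {τ : Type*} {l : ℕ} (f : ℕ → τ)
    (hf : ∀ m, 0 < m → m < l + 2 → ∀ i, f i ≠ f (i + m)) (s : ℕ) :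
    Function.Injective (fun i : Fin (l + 2) => f (s + i)) := by
  intro a b hab
  by_contra hne
  rcases lt_or_gt_of_ne hne with h | h
  · refine hf (b - a) (by omega) (by omega) (s + a) ?_
    simp only at hab
    rw [hab]; congr 1; omega
  · refine hf (a - b) (by omega) (by omega) (s + b) ?_
    simp only at hab
    rw [← hab]; congr 1; omega

/-- A walk in a set system that never backtracks and revisits an edge contains a Berge cycle. -/
theorem exists_cycle_of_walk {ι σ : Type*} (v : ℕ → ι) (e : ℕ → σ) (inc : ι → σ → Prop)
    (hv : ∀ n, v (n + 1) ≠ v n) (he : ∀ n, e (n + 1) ≠ e n)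
    (h₁ : ∀ n, inc (v (n + 1)) (e n))
    (hrep : ∃ i j, i < j ∧ e i = e j) :
    ∃ (l s : ℕ), Function.Injective (fun i : Fin (l + 2) => v (s + i)) ∧
      Function.Injective (fun i : Fin (l + 2) => e (s + i)) ∧
      inc (v s) (e (s + (l + 1))) := by
  classical
  -- Take the least shift at which either sequence repeats. By minimality both sequences are
  -- injective on windows of that length.
  let P : ℕ → Prop := fun d => 0 < d ∧ ∃ i, v i = v (i + d) ∨ e i = e (i + d)
  have hP : ∃ d, P d := by
    obtain ⟨i, j, hij, h⟩ := hrep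
    exact ⟨j - i, by omega, i, Or.inr (by rw [h]; congr 1; omega)⟩
  obtain ⟨hd0, i, hi⟩ := Nat.find_spec hP
  have hmin : ∀ m, m < Nat.find hP → ¬ P m := fun m => Nat.find_min hP
  set d := Nat.find hP
  have hd1 : d ≠ 1 := by
    intro h
    rw [h] at hi
    rcases hi with hi | hi
    · exact hv i hi.symm
    · exact he i hi.symm
  obtain ⟨l, hl⟩ : ∃ l, d = l + 2 := ⟨d - 2, by omega⟩
  rw [hl] at hi hmin
  have hvi := injective_window (l := l) v fun m h0 h1 i h => hmin m h1 ⟨h0, i, Or.inl h⟩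
  have hei := injective_window (l := l) e fun m h0 h1 i h => hmin m h1 ⟨h0, i, Or.inr h⟩
  -- A vertex repetition closes the window starting at `i`. For an edge repetition the window starts
  -- at `i + 1`: its last edge is `e i`, which contains `v (i + 1)`.
  rcases hi with hi | hi
  · refine ⟨l, i, hvi i, hei i, ?_⟩
    rw [hi]
    exact h₁ _
  · refine ⟨l, i + 1, hvi _, hei _, ?_⟩
    have : i + 1 + (l + 1) = i + (l + 2) := by omega
    rw [this, ← hi]
    exact h₁ i

open Finset in
/-- A uniform family with too many edges for the vertices it covers contains a Berge cycle. -/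
theorem exists_cycle_of_card_biUnion_le {ι : Type*} [DecidableEq ι] {r : ℕ} (hr : 0 < r)
    (E : Finset (Finset ι)) (hE : E.Nonempty) (hu : ∀ e ∈ E, #e = r)
    (hc : #(E.biUnion id) ≤ (r - 1) * #E) :
    ∃ (l : ℕ) (v : Fin (l + 2) → ι) (e : Fin (l + 2) → Finset ι),
      v.Injective ∧ e.Injective ∧ ∀ i, e i ∈ E ∧ v i ∈ e i ∧ v (i + 1) ∈ e i := by
  induction E using Finset.strongInduction with
  | H E ih =>
  -- Pass to a minimal bad subfamily: afterwards every nonempty proper subfamily `F` covers more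
  -- than `(r - 1) * #F` vertices.
  by_cases hsub : ∃ F, F ⊂ E ∧ F.Nonempty ∧ #(F.biUnion id) ≤ (r - 1) * #F
  · obtain ⟨F, hF, hFn, hFc⟩ := hsub
    obtain ⟨l, v, e, h1, h2, h3⟩ := ih F hF hFn (fun e he => hu e (hF.1 he)) hFc
    exact ⟨l, v, e, h1, h2, fun i => ⟨hF.1 (h3 i).1, (h3 i).2⟩⟩
  push Not at hsub
  -- One step of a walk: leave the current edge through a vertex other than the entry vertex, into a
  -- different edge.
  have hstep : ∀ p : ι × E, ∃ q : ι × E, q.1 ∈ q.2.1 ∧ q.1 ∈ p.2.1 ∧ q.1 ≠ p.1 ∧ q.2 ≠ p.2 := by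
    rintro ⟨x, e, he⟩
    -- Removing `e` loses `r` minus the size of this intersection from the covered set. By
    -- minimality the loss is less than `r - 1`, so two exits exist and one differs from `x`.
    have hcard : 1 < #(e ∩ (E.erase e).biUnion id) := by
      have hsplit : E.biUnion id = (E.erase e).biUnion id ∪ e := by
        conv_lhs => rw [← insert_erase he, biUnion_insert]
        rw [union_comm]; rfl
      have h1 := card_union_add_card_inter ((E.erase e).biUnion id) e
      rw [← hsplit, inter_comm, hu e he] at h1
      have h2 : #(E.erase e) + 1 = #E := card_erase_add_one he
      rw [← h2, mul_add, mul_one] at hc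
      rcases (E.erase e).eq_empty_or_nonempty with h0 | h0
      · rw [h0] at h1 hc
        simp at h1 hc
        omega
      · have h3 := hsub _ (erase_ssubset he) h0
        omega
    obtain ⟨y, hy, hyx⟩ := exists_mem_ne hcard x
    rw [mem_inter, mem_biUnion] at hy
    obtain ⟨hye, f, hf, hyf⟩ := hy
    rw [mem_erase] at hf
    exact ⟨(y, ⟨f, hf.2⟩), hyf, hye, hyx, fun h => hf.1 (congrArg Subtype.val h)⟩
  choose next h1 h2 h3 h4 using hstep
  obtain ⟨e₀, he₀⟩ := hE
  obtain ⟨x₀, hx₀⟩ : e₀.Nonempty := card_pos.1 (by rw [hu _ he₀]; exact hr)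
  let s : ℕ → ι × E := fun n => next^[n] (x₀, ⟨e₀, he₀⟩)
  have hs : ∀ n, s (n + 1) = next (s n) := fun n => Function.iterate_succ_apply' _ _ _
  have hmem : ∀ n, (s n).1 ∈ (s n).2.1 := by
    rintro (_ | n)
    · exact hx₀
    · rw [hs]; exact h1 _
  obtain ⟨l, k, ha, hb, hc⟩ := exists_cycle_of_walk (fun n => (s n).1) (fun n => (s n).2)
    (fun x e => x ∈ e.1) (fun n => by simp only [hs]; exact h3 _)
    (fun n => by simp only [hs]; exact h4 _) (fun n => by simp only [hs]; exact h2 _) (by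
      obtain ⟨i, j, hij, h⟩ := Finite.exists_ne_map_eq_of_infinite (fun n => (s n).2)
      rcases lt_or_gt_of_ne hij with h' | h'
      · exact ⟨i, j, h', h⟩
      · exact ⟨j, i, h', h.symm⟩)
  refine ⟨l, fun i => (s (k + i)).1, fun i => (s (k + i)).2.1, ha,
    Subtype.val_injective.comp hb, fun i => ⟨(s (k + i)).2.2, hmem _, ?_⟩⟩
  by_cases hi : i = Fin.last (l + 1)
  · subst hi
    simpa using hc
  · have : ((i + 1 : Fin (l + 2)) : ℕ) = i + 1 :=
      Fin.val_add_one_of_lt (lt_of_le_of_ne (Fin.le_last i) hi)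
    simp only [this, ← add_assoc, hs]
    exact h2 _

open Finset in
/-- A connected uniform family with a Berge cycle has few vertices. -/
theorem card_le_of_cycle {ι : Type*} [DecidableEq ι] [Fintype ι] {r : ℕ}
    (E : Finset (Finset ι)) (hu : ∀ e ∈ E, #e = r)
    (hconn : ∀ U : Finset ι, U.Nonempty → U ≠ univ → ∃ e ∈ E, ∃ x ∈ e, x ∈ U ∧ ∃ y ∈ e, y ∉ U)
    {l : ℕ} {v : Fin (l + 2) → ι} {e : Fin (l + 2) → Finset ι}
    (hv : v.Injective) (he : e.Injective) (h : ∀ i, e i ∈ E ∧ v i ∈ e i ∧ v (i + 1) ∈ e i) :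
    Fintype.card ι ≤ (r - 1) * #E := by
  classical
  let S := E.powerset.filter fun F => F.Nonempty ∧ #(F.biUnion id) ≤ (r - 1) * #F
  have hS : S.Nonempty := by
    refine ⟨univ.image e, mem_filter.2 ⟨mem_powerset.2 ?_, by simp, ?_⟩⟩
    · rw [image_subset_iff]; exact fun i _ => (h i).1
    · rw [card_image_of_injective _ he, card_univ, Fintype.card_fin, mul_comm]
      -- On the cycle `v i` also lies in the preceding edge, so it may be dropped from `e i`; the
      -- union is covered by sets of size `r - 1`.
      have hsub : (univ.image e).biUnion id ⊆ univ.biUnion fun i => (e i).erase (v i) := by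
        intro x hx
        simp only [mem_biUnion, mem_image, mem_univ, true_and, exists_exists_eq_and, id,
          mem_erase] at hx ⊢
        obtain ⟨i, hx⟩ := hx
        by_cases hxi : x = v i
        · refine ⟨i - 1, ?_, ?_⟩
          · rw [hxi]
            intro hh
            exact one_ne_zero (sub_eq_self.1 (hv hh).symm)
          · have := (h (i - 1)).2.2
            rwa [sub_add_cancel, ← hxi] at this
        · exact ⟨i, hxi, hx⟩
      refine (card_le_card hsub).trans (card_biUnion_le.trans ?_)
      rw [sum_congr rfl fun i _ => by rw [card_erase_of_mem (h i).2.1, hu _ (h i).1]]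
      simp
  -- A largest such subfamily covers all vertices: a crossing edge would add at most `r - 1` new
  -- vertices, so it could be adjoined.
  obtain ⟨F, hF, hmax⟩ := exists_max_image S card hS
  obtain ⟨hFE, hFn, hFc⟩ := mem_filter.1 hF
  rw [mem_powerset] at hFE
  have huniv : F.biUnion id = univ := by
    by_contra hne
    have hne' : (F.biUnion id).Nonempty := by
      obtain ⟨f, hf⟩ := hFn
      by_contra hemp
      obtain ⟨x, hx⟩ : f.Nonempty := by
        have h0 := hu (e 0) (h 0).1
        have : 0 < #(e 0) := card_pos.2 ⟨_, (h 0).2.1⟩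
        exact card_pos.1 (by rw [hu f (hFE hf)]; omega)
      exact hemp ⟨x, mem_biUnion.2 ⟨f, hf, hx⟩⟩
    obtain ⟨f, hf, x, hxf, hxU, y, hyf, hyU⟩ := hconn _ hne' hne
    have hfF : f ∉ F := fun hfF => hyU (mem_biUnion.2 ⟨f, hfF, hyf⟩)
    have hin : insert f F ∈ S := by
      refine mem_filter.2 ⟨mem_powerset.2 (insert_subset hf hFE), insert_nonempty _ _, ?_⟩
      rw [card_insert_of_notMem hfF, biUnion_insert, union_comm, mul_add, mul_one]
      have h1 := card_union_add_card_inter (F.biUnion id) f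
      have h2 : 0 < #(F.biUnion id ∩ f) := card_pos.2 ⟨x, mem_inter.2 ⟨hxU, hxf⟩⟩
      rw [hu f hf] at h1
      simp only [id] at h1 h2 hFc ⊢
      omega
    have := hmax _ hin
    rw [card_insert_of_notMem hfF] at this
    omega
  rw [huniv, card_univ] at hFc
  exact hFc.trans (Nat.mul_le_mul_left _ (card_le_card hFE))

/-! ### Matching sums as sums over edge assignments. -/

open Classical in
/-- The sets of pairwise disjoint members of a finite family. -/
noncomputable def matchings {ι : Type*} (E : Finset (Finset ι)) : Finset (Finset (Finset ι)) :=
  E.powerset.filter fun M => ((M : Set (Finset ι))).PairwiseDisjoint id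

theorem mem_matchings {ι : Type*} {E M : Finset (Finset ι)} :
    M ∈ matchings E ↔ M ⊆ E ∧ (M : Set (Finset ι)).PairwiseDisjoint id := by
  simp [matchings]

open Finset in
/-- Expansion of a weighted matching sum over assignments of an incident edge (or nothing) to each
vertex: only assignments in which no edge is chosen by all of its vertices survive. -/
theorem sum_matchings_eq_sum_assignments {ι R : Type*} [DecidableEq ι] [Fintype ι] [CommRing R]
    {r : ℕ} (E : Finset (Finset ι)) (hu : ∀ e ∈ E, #e = r)
    (y : Finset ι → R) (s : ι → R) :
    ∑ M ∈ matchings E,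
      (-1) ^ #M * ((∏ e ∈ M, y e ^ r) *
        ∏ v ∈ (M.biUnion id)ᶜ, (s v + ∑ e ∈ E.filter (v ∈ ·), y e)) =
    ∑ f ∈ (Fintype.piFinset fun v : ι => insertNone (E.filter (v ∈ ·))).filter
        (fun f => ∀ e ∈ E, ∃ v ∈ e, f v ≠ some e),
      ∏ v, (f v).elim (s v) y := by
  classical
  set P := Fintype.piFinset fun v : ι => insertNone (E.filter (v ∈ ·)) with hP
  -- The term of `M` collects the assignments for which every edge of `M` is chosen by all its
  -- vertices: choices are forced on `M` and free elsewhere, so the sum factors over vertices.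
  have key : ∀ M ∈ matchings E,
      (∏ e ∈ M, y e ^ r) * ∏ v ∈ (M.biUnion id)ᶜ, (s v + ∑ e ∈ E.filter (v ∈ ·), y e) =
      ∑ f ∈ P.filter (fun f => ∀ e ∈ M, ∀ v ∈ e, f v = some e), ∏ v, (f v).elim (s v) y := by
    intro M hM
    obtain ⟨hME, hMd⟩ := mem_matchings.1 hM
    let t : ι → Finset (Option (Finset ι)) := fun v =>
      (insertNone (E.filter (v ∈ ·))).filter fun o => ∀ e ∈ M, v ∈ e → o = some e
    have ht : P.filter (fun f => ∀ e ∈ M, ∀ v ∈ e, f v = some e) = Fintype.piFinset t := by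
      ext f
      simp only [hP, t, mem_filter, Fintype.mem_piFinset]
      exact ⟨fun h v => ⟨h.1 v, fun e he hv => h.2 e he v hv⟩,
        fun h => ⟨fun v => (h v).1, fun e he v hv => (h v).2 e he hv⟩⟩
    rw [ht, ← prod_univ_sum t fun v o => o.elim (s v) y, ← prod_mul_prod_compl (M.biUnion id), prod_biUnion hMd]
    congr 1
    · refine prod_congr rfl fun e he => ?_
      have : ∀ v ∈ e, ∑ o ∈ t v, o.elim (s v) y = y e := by
        intro v hv
        have : t v = {some e} := by
          ext o
          simp only [t, mem_filter, mem_singleton]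
          constructor
          · exact fun h => h.2 e he hv
          · rintro rfl
            refine ⟨by simp [hME he, hv], fun f hf hvf => ?_⟩
            by_contra hne
            have hd := hMd he hf (fun h => hne (by rw [h]))
            exact disjoint_left.1 hd hv hvf
        rw [this, sum_singleton]
        rfl
      simp only [id]
      rw [prod_congr rfl this, prod_const, hu e (hME he)]
    · refine prod_congr rfl fun v hv => ?_
      have : t v = insertNone (E.filter (v ∈ ·)) := by
        refine filter_true_of_mem fun o _ e he hve => ?_
        exact absurd (mem_biUnion.2 ⟨e, he, hve⟩) (mem_compl.1 hv)
      rw [this, sum_insertNone]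
      rfl
  rw [sum_congr rfl fun M hM => by rw [key M hM, mul_sum]]
  -- For fixed `f`, any set of edges chosen by all their vertices is already a matching, since `f v`
  -- names at most one edge. The alternating sum over all such sets vanishes unless there is no such
  -- edge.
  rw [sum_comm' (t' := P) (s' := fun f => (E.filter fun e => ∀ v ∈ e, f v = some e).powerset)]
  · rw [sum_filter]
    refine sum_congr rfl fun f _ => ?_
    rw [← sum_mul]
    have h0 := congrArg (Int.cast : ℤ → R)
      (sum_powerset_neg_one_pow_card (x := E.filter fun e => ∀ v ∈ e, f v = some e))
    push_cast at h0
    rw [h0]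
    simp only [filter_eq_empty_iff, not_forall, exists_prop]
    split_ifs <;> simp
  · intro M f
    simp only [mem_matchings, mem_filter, mem_powerset, subset_iff]
    constructor
    · rintro ⟨⟨hM, -⟩, hf, h⟩
      exact ⟨fun e he => ⟨hM he, h e he⟩, hf⟩
    · rintro ⟨h, hf⟩
      refine ⟨⟨fun e he => (h he).1, fun e he e' he' hne => ?_⟩, hf, fun e he => (h he).2⟩
      refine disjoint_left.2 fun v hv hv' => hne ?_
      have := ((h he).2 v hv).symm.trans ((h he').2 v hv')
      exact Option.some.inj this

open Finset in
/-- The matching polynomial evaluated at `t`, in terms of a positive solution `x` of the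
eigenvalue equations for `c`. -/
theorem matchingSum_mul_prod_pow {ι : Type*} [DecidableEq ι] [Fintype ι] {r : ℕ}
    (E : Finset (Finset ι)) (hu : ∀ e ∈ E, #e = r) {x : ι → ℝ} {c : ℝ}
    (hx : ∀ i, c * x i ^ r = ∑ e ∈ E.filter (i ∈ ·), ∏ j ∈ e, x j) (t : ℝ) :
    (∑ M ∈ matchings E, (-1) ^ #M * t ^ (Fintype.card ι - #M * r)) * ∏ i, x i ^ r =
    ∑ f ∈ (Fintype.piFinset fun v : ι => insertNone (E.filter (v ∈ ·))).filter
        (fun f => ∀ e ∈ E, ∃ v ∈ e, f v ≠ some e),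
      ∏ v, (f v).elim ((t - c) * x v ^ r) (fun e => ∏ j ∈ e, x j) := by
  rw [← sum_matchings_eq_sum_assignments E hu, sum_mul]
  refine sum_congr rfl fun M hM => ?_
  obtain ⟨hME, hMd⟩ := mem_matchings.1 hM
  rw [mul_assoc]
  congr 1
  -- The weight `(t - c) * x v ^ r` for choosing nothing is what makes the total weight at `v` equal
  -- `t * x v ^ r`.
  have h1 : ∀ v, (t - c) * x v ^ r + ∑ e ∈ E.filter (v ∈ ·), ∏ j ∈ e, x j = t * x v ^ r := by
    intro v
    rw [← hx]
    ring
  have hcard : #(M.biUnion id) = #M * r := by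
    rw [card_biUnion fun e he f hf hne => hMd he hf hne]
    exact sum_const_nat fun e he => hu e (hME he)
  simp only [h1]
  rw [prod_mul_distrib, prod_const, card_compl, hcard, ← prod_mul_prod_compl (M.biUnion id),
    prod_biUnion hMd]
  simp only [prod_pow, id]
  ring

-- At `t = c` an assignment using `none` has weight zero. Any other one selects an edge at each
-- vertex, but at most `r - 1` vertices can select the same edge, so there are too few edges.
open Finset in
theorem matchingSum_eq_zero {ι : Type*} [DecidableEq ι] [Fintype ι] {r : ℕ}
    (E : Finset (Finset ι)) (hu : ∀ e ∈ E, #e = r) (hcard : (r - 1) * #E < Fintype.card ι)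
    {x : ι → ℝ} {c : ℝ} (hx0 : ∀ i, 0 < x i)
    (hx : ∀ i, c * x i ^ r = ∑ e ∈ E.filter (i ∈ ·), ∏ j ∈ e, x j) :
    ∑ M ∈ matchings E, (-1) ^ #M * c ^ (Fintype.card ι - #M * r) = 0 := by
  have h := matchingSum_mul_prod_pow E hu hx c
  have hpos : ∏ i, x i ^ r ≠ 0 := (prod_pos fun i _ => pow_pos (hx0 i) r).ne'
  refine (mul_eq_zero.1 (h.trans (sum_eq_zero fun f hf => ?_))).resolve_right hpos
  rw [mem_filter, Fintype.mem_piFinset] at hf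
  obtain ⟨hf, hfull⟩ := hf
  by_cases hnone : ∃ v, f v = none
  · obtain ⟨v, hv⟩ := hnone
    exact prod_eq_zero (mem_univ v) (by simp [hv])
  · exfalso
    push Not at hnone
    have hsome : ∀ v, ∃ e ∈ E, v ∈ e ∧ f v = some e := by
      intro v
      obtain ⟨e, he⟩ := Option.ne_none_iff_exists'.1 (hnone v)
      have := hf v
      rw [he, some_mem_insertNone, mem_filter] at this
      exact ⟨e, this.1, this.2, he⟩
    have hsub : (univ : Finset ι) ⊆ E.biUnion fun e => e.filter fun v => f v = some e := by
      intro v _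
      obtain ⟨e, he, hve, hfe⟩ := hsome v
      exact mem_biUnion.2 ⟨e, he, mem_filter.2 ⟨hve, hfe⟩⟩
    have h2 : #(E.biUnion fun e => e.filter fun v => f v = some e) ≤ #E * (r - 1) := by
      refine card_biUnion_le_card_mul _ _ _ fun e he => ?_
      obtain ⟨v, hve, hv⟩ := hfull e he
      have hlt : #(e.filter fun v => f v = some e) < #e :=
        card_lt_card (filter_ssubset.2 ⟨v, hve, hv⟩)
      rw [hu e he] at hlt
      omega
    have h3 := card_le_card hsub
    rw [card_univ] at h3
    rw [mul_comm] at h2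
    omega

-- For `t > c` all weights are positive, and the assignment choosing nothing everywhere is
-- admissible because edges are nonempty.
open Finset in
theorem matchingSum_pos {ι : Type*} [DecidableEq ι] [Fintype ι] {r : ℕ} (hr : 0 < r)
    (E : Finset (Finset ι)) (hu : ∀ e ∈ E, #e = r)
    {x : ι → ℝ} {c t : ℝ} (hx0 : ∀ i, 0 < x i)
    (hx : ∀ i, c * x i ^ r = ∑ e ∈ E.filter (i ∈ ·), ∏ j ∈ e, x j) (ht : c < t) :
    0 < ∑ M ∈ matchings E, (-1) ^ #M * t ^ (Fintype.card ι - #M * r) := by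
  have h := matchingSum_mul_prod_pow E hu hx t
  have hpos : 0 < ∏ i, x i ^ r := prod_pos fun i _ => pow_pos (hx0 i) r
  refine pos_of_mul_pos_left (h ▸ ?_) hpos.le
  have hpos' : ∀ (f : ι → Option (Finset ι)) v,
      0 < (f v).elim ((t - c) * x v ^ r) (fun e => ∏ j ∈ e, x j) := by
    intro f v
    cases f v with
    | none => exact mul_pos (sub_pos.2 ht) (pow_pos (hx0 v) r)
    | some e => exact prod_pos fun j _ => hx0 j
  refine sum_pos (fun f _ => prod_pos fun v _ => hpos' f v) ⟨fun _ => none, ?_⟩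
  rw [mem_filter, Fintype.mem_piFinset]
  refine ⟨fun v => none_mem_insertNone, fun e he => ?_⟩
  obtain ⟨v, hv⟩ : e.Nonempty := card_pos.1 (by rw [hu e he]; exact hr)
  exact ⟨v, hv, by simp⟩

/-! ### The Perron vector and its dominance. -/

open Finset in
/-- A nonnegative weight vector maximising the edge-product sum on the unit `r`-sphere. -/
theorem exists_max_edgeSum {ι : Type*} [DecidableEq ι] [Fintype ι] [Nonempty ι] {r : ℕ}
    (hr : 0 < r) (E : Finset (Finset ι)) (hu : ∀ e ∈ E, #e = r) :
    ∃ x : ι → ℝ, (∀ i, 0 ≤ x i) ∧ ∑ i, x i ^ r = 1 ∧ ∀ y : ι → ℝ, (∀ i, 0 ≤ y i) →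
      ∑ e ∈ E, ∏ j ∈ e, y j ≤ (∑ e ∈ E, ∏ j ∈ e, x j) * ∑ i, y i ^ r := by
  have hr' : r ≠ 0 := hr.ne'
  let K : Set (ι → ℝ) := (Set.univ.pi fun _ => Set.Icc 0 1) ∩ {x | ∑ i, x i ^ r = 1}
  have hK : IsCompact K :=
    (isCompact_univ_pi fun _ => isCompact_Icc).inter_right
      (isClosed_eq (by fun_prop) continuous_const)
  have hKmem : ∀ y : ι → ℝ, (∀ i, 0 ≤ y i) → ∑ i, y i ^ r = 1 → y ∈ K := by
    refine fun y hy h1 => ⟨fun i _ => ⟨hy i, ?_⟩, h1⟩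
    have : y i ^ r ≤ 1 := h1 ▸ single_le_sum (f := fun i => y i ^ r)
      (fun i _ => pow_nonneg (hy i) r) (mem_univ i)
    exact (pow_le_one_iff_of_nonneg (hy i) hr').1 this
  obtain ⟨a⟩ := ‹Nonempty ι›
  have hKn : K.Nonempty := by
    refine ⟨Pi.single a 1, hKmem _ (fun i => ?_) ?_⟩
    · by_cases h : i = a
      · subst h; simp
      · simp [h]
    · rw [sum_eq_single a (fun b _ hb => by simp [hb, hr']) (by simp)]
      simp
  obtain ⟨x, hxK, hmax⟩ := hK.exists_isMaxOn hKn
    (f := fun x => ∑ e ∈ E, ∏ j ∈ e, x j) (by fun_prop)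
  refine ⟨x, fun i => (hxK.1 i (Set.mem_univ i)).1, hxK.2, fun y hy => ?_⟩
  have hS : 0 ≤ ∑ i, y i ^ r := sum_nonneg fun i _ => pow_nonneg (hy i) r
  rcases hS.eq_or_lt with h0 | h0
  · have hy0 : ∀ i, y i = 0 := fun i =>
      eq_zero_of_pow_eq_zero (((sum_eq_zero_iff_of_nonneg fun i _ =>
        pow_nonneg (hy i) r).1 h0.symm) i (mem_univ i))
    rw [← h0, mul_zero]
    refine (sum_eq_zero fun e he => ?_).le
    obtain ⟨v, hv⟩ : e.Nonempty := card_pos.1 (by rw [hu e he]; exact hr)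
    exact prod_eq_zero hv (hy0 v)
  · set S := ∑ i, y i ^ r
    set c := S ^ (r : ℝ)⁻¹ with hc
    have hcr : c ^ r = S := Real.rpow_inv_natCast_pow hS hr'
    have hc0 : 0 < c := Real.rpow_pos_of_pos h0 _
    have hmem : (fun i => y i / c) ∈ K := by
      refine hKmem _ (fun i => div_nonneg (hy i) hc0.le) ?_
      simp only [div_pow, hcr, ← sum_div]
      exact div_self h0.ne'
    have h1 : ∑ e ∈ E, ∏ j ∈ e, y j / c ≤ ∑ e ∈ E, ∏ j ∈ e, x j := hmax hmem
    have h2 : ∑ e ∈ E, ∏ j ∈ e, y j / c = (∑ e ∈ E, ∏ j ∈ e, y j) / S := by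
      rw [sum_div]
      refine sum_congr rfl fun e he => ?_
      rw [prod_div_distrib, prod_const, hu e he, hcr]
    rw [h2] at h1
    exact (div_le_iff₀ h0).1 h1

open Finset in
/-- For a connected family, the maximiser is positive. -/
theorem max_edgeSum_pos {ι : Type*} [DecidableEq ι] [Fintype ι] {r : ℕ}
    (hr : 0 < r) (E : Finset (Finset ι)) (hu : ∀ e ∈ E, #e = r)
    (hconn : ∀ U : Finset ι, U.Nonempty → U ≠ univ → ∃ e ∈ E, ∃ x ∈ e, x ∈ U ∧ ∃ y ∈ e, y ∉ U)
    {x : ι → ℝ} (hx : ∀ i, 0 ≤ x i) (h1 : ∑ i, x i ^ r = 1)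
    (hmax : ∀ y : ι → ℝ, (∀ i, 0 ≤ y i) →
      ∑ e ∈ E, ∏ j ∈ e, y j ≤ (∑ e ∈ E, ∏ j ∈ e, x j) * ∑ i, y i ^ r) (i : ι) : 0 < x i := by
  set μ := ∑ e ∈ E, ∏ j ∈ e, x j
  have hμ : 0 ≤ μ := sum_nonneg fun e _ => prod_nonneg fun j _ => hx j
  by_contra hi
  obtain ⟨e, he, a, hae, ha, b, hbe, hb⟩ := hconn (univ.filter fun i => 0 < x i) (by
      by_contra hemp
      rw [not_nonempty_iff_eq_empty, filter_eq_empty_iff] at hemp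
      have : ∑ i, x i ^ r = 0 := sum_eq_zero fun i _ => by
        rw [le_antisymm (not_lt.1 (hemp (mem_univ i))) (hx i), zero_pow hr.ne']
      rw [this] at h1
      exact zero_ne_one h1) (fun h => hi (by
      have := mem_univ i
      rw [← h] at this
      exact (mem_filter.1 this).2))
  have ha : 0 < x a := (mem_filter.1 ha).2
  have hb : x b = 0 :=
    le_antisymm (not_lt.1 fun h => hb (mem_filter.2 ⟨mem_univ b, h⟩)) (hx b)
  -- Replace the zero entries of `x` by `ε`. The norm sum grows by `k * ε ^ r`, while the crossing
  -- edge gains at least `c * ε ^ (r - 1)`, since its vertex `a` has a positive entry. This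
  -- contradicts maximality for small `ε`.
  let z : ι → ℝ := fun i => if x i = 0 then 1 else x i
  have hz : ∀ i, 0 < z i := fun i => by
    by_cases h : x i = 0
    · simp [z, h]
    · simpa [z, h] using lt_of_le_of_ne (hx i) (Ne.symm h)
  set c := x a * ∏ i ∈ e.erase a, z i
  have hc : 0 < c := mul_pos ha (prod_pos fun i _ => hz i)
  set k : ℝ := ((#(univ.filter fun i => x i = 0) : ℕ) : ℝ)
  have hk : 0 ≤ k := Nat.cast_nonneg _
  have key : ∀ ε : ℝ, 0 < ε → ε ≤ 1 → c ≤ μ * k * ε := by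
    intro ε hε hε1
    let y : ι → ℝ := fun i => if x i = 0 then ε else x i
    have hy : ∀ i, 0 ≤ y i := fun i => by
      by_cases h : x i = 0
      · simpa [y, h] using hε.le
      · simpa [y, h] using hx i
    have hxy : ∀ i, x i ≤ y i := fun i => by
      by_cases h : x i = 0
      · simpa [y, h] using hε.le
      · simp [y, h]
    have hzy : ∀ i, ε * z i ≤ y i := fun i => by
      by_cases h : x i = 0
      · simp [y, z, h]
      · simpa [y, z, h] using mul_le_of_le_one_left (hx i) hε1
    have hy1 : ∑ i, y i ^ r = 1 + k * ε ^ r := by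
      have : ∀ i, y i ^ r = x i ^ r + if x i = 0 then ε ^ r else 0 := fun i => by
        by_cases h : x i = 0
        · simp [y, h, hr.ne']
        · simp [y, h]
      rw [sum_congr rfl fun i _ => this i, sum_add_distrib, h1, ← sum_filter, sum_const,
        nsmul_eq_mul]
    have hy2 : μ + c * ε ^ (r - 1) ≤ ∑ e ∈ E, ∏ j ∈ e, y j := by
      rw [← sum_erase_add _ _ he]
      refine add_le_add ?_ ?_
      · refine (sum_erase_add E _ he).symm.le.trans ?_
        rw [prod_eq_zero hbe hb, add_zero]
        exact sum_le_sum fun f _ => prod_le_prod (fun j _ => hx j) fun j _ => hxy j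
      · rw [← mul_prod_erase e _ hae]
        calc c * ε ^ (r - 1) = x a * ∏ i ∈ e.erase a, (ε * z i) := by
              rw [prod_mul_distrib, prod_const, card_erase_of_mem hae, hu e he]
              simp only [c]
              ring
          _ ≤ y a * ∏ i ∈ e.erase a, y i :=
            mul_le_mul (hxy a) (prod_le_prod (fun j _ => (mul_pos hε (hz j)).le) fun j _ => hzy j)
              (prod_nonneg fun j _ => (mul_pos hε (hz j)).le) (hy a)
    have h := hy2.trans (hmax y hy)
    rw [hy1] at h
    have hpow : ε ^ r = ε ^ (r - 1) * ε := by rw [← pow_succ, Nat.sub_add_cancel hr]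
    have h' : c * ε ^ (r - 1) ≤ μ * k * ε * ε ^ (r - 1) := by
      rw [hpow] at h
      linarith
    exact le_of_mul_le_mul_right h' (pow_pos hε _)
  have hden : 0 < c + μ * k + 1 := by positivity
  have h := key (c / (c + μ * k + 1)) (by positivity)
    ((div_le_one hden).2 (by nlinarith [mul_nonneg hμ hk]))
  rw [mul_div_assoc', le_div_iff₀ hden] at h
  nlinarith

open Finset in
/-- The Perron vector of a connected uniform family. -/
theorem exists_perron_vector {ι : Type*} [DecidableEq ι] [Fintype ι] [Nonempty ι] {r : ℕ}
    (hr : 0 < r) (E : Finset (Finset ι)) (hu : ∀ e ∈ E, #e = r)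
    (hconn : ∀ U : Finset ι, U.Nonempty → U ≠ univ → ∃ e ∈ E, ∃ x ∈ e, x ∈ U ∧ ∃ y ∈ e, y ∉ U) :
    ∃ (x : ι → ℝ) (c : ℝ), (∀ i, 0 < x i) ∧ 0 ≤ c ∧
      ∀ i, ∑ e ∈ E.filter (i ∈ ·), ∏ j ∈ e.erase i, x j = c * x i ^ (r - 1) := by
  obtain ⟨x, hx, h1, hmax⟩ := exists_max_edgeSum hr E hu
  have hpos := max_edgeSum_pos hr E hu hconn hx h1 hmax
  set μ := ∑ e ∈ E, ∏ j ∈ e, x j with hμ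
  refine ⟨x, μ * r, hpos, mul_nonneg (sum_nonneg fun e _ => prod_nonneg fun j _ => hx j)
    (Nat.cast_nonneg r), fun i => ?_⟩
  -- Vary coordinate `i` alone: the edge sum is `t * a + b` and the norm sum `t ^ r + d`. The gap
  -- `g` in the maximality inequality is minimal at `x i`, and its vanishing derivative is the
  -- eigenvalue equation, with eigenvalue `μ * r`.
  set a := ∑ e ∈ E.filter (i ∈ ·), ∏ j ∈ e.erase i, x j
  set b := ∑ e ∈ E.filter (i ∉ ·), ∏ j ∈ e, x j
  set d := ∑ j ∈ univ.erase i, x j ^ r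
  have hP : ∀ t, ∑ e ∈ E, ∏ j ∈ e, Function.update x i t j = t * a + b := by
    intro t
    rw [← sum_filter_add_sum_filter_not E (i ∈ ·), mul_sum]
    congr 1
    · refine sum_congr rfl fun e he => ?_
      rw [← mul_prod_erase e _ (mem_filter.1 he).2, Function.update_self]
      congr 1
      exact prod_congr rfl fun j hj => Function.update_of_ne (ne_of_mem_erase hj) _ _
    · refine sum_congr rfl fun e he => prod_congr rfl fun j hj => Function.update_of_ne ?_ _ _
      rintro rfl
      exact (mem_filter.1 he).2 hj
  have hN : ∀ t, ∑ j, Function.update x i t j ^ r = t ^ r + d := by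
    intro t
    rw [← add_sum_erase _ _ (mem_univ i), Function.update_self]
    congr 1
    exact sum_congr rfl fun j hj => by rw [Function.update_of_ne (ne_of_mem_erase hj)]
  let g : ℝ → ℝ := fun t => μ * (t ^ r + d) - (t * a + b)
  have hg : ∀ t, 0 ≤ t → 0 ≤ g t := by
    intro t ht
    have := hmax (Function.update x i t) fun j => by
      by_cases h : j = i
      · subst h; simpa using ht
      · simpa [h] using hx j
    rw [hP, hN] at this
    exact sub_nonneg.2 this
  have hg0 : g (x i) = 0 := by
    have e1 := hP (x i)
    have e2 := hN (x i)
    rw [Function.update_eq_self] at e1 e2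
    simp only [g]
    rw [← e1, ← e2, h1, mul_one, sub_self]
  have hmin : IsLocalMin g (x i) := by
    filter_upwards [lt_mem_nhds (hpos i)] with t ht
    rw [hg0]
    exact hg t ht.le
  have hd : HasDerivAt g (μ * (r * x i ^ (r - 1)) - a) (x i) := by
    have e1 := (((hasDerivAt_pow r (x i)).add_const d).const_mul μ)
    have e2 := (((hasDerivAt_id (x i)).mul_const a).add_const b)
    refine (e1.sub e2).congr_deriv ?_
    ring
  have := hmin.hasDerivAt_eq_zero hd
  linarith

open Finset in
/-- The eigenvalue of a positive eigenvector dominates all eigenvalues. -/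
theorem norm_eigenvalue_le {ι : Type*} [DecidableEq ι] [Fintype ι] {r : ℕ}
    (E : Finset (Finset ι)) (hu : ∀ e ∈ E, #e = r) {x : ι → ℝ} {c : ℝ} (hx : ∀ i, 0 < x i)
    (hxc : ∀ i, ∑ e ∈ E.filter (i ∈ ·), ∏ j ∈ e.erase i, x j = c * x i ^ (r - 1))
    {z : ι → ℂ} {a : ℂ} (hz : z ≠ 0)
    (hza : ∀ i, ∑ e ∈ E.filter (i ∈ ·), ∏ j ∈ e.erase i, z j = a * z i ^ (r - 1)) :
    ‖a‖ ≤ c := by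
  obtain ⟨k, hk⟩ := Function.ne_iff.1 hz
  -- At an index maximising `‖z i‖ / x i` the bound `‖z‖ ≤ m * x` is an equality, so the equation
  -- there compares `‖a‖` with `c`.
  obtain ⟨i, -, hi⟩ := exists_max_image univ (fun i => ‖z i‖ / x i) ⟨k, mem_univ k⟩
  set m := ‖z i‖ / x i
  have hm : 0 < m := (div_pos (norm_pos_iff.2 hk) (hx k)).trans_le (hi k (mem_univ k))
  have hle : ∀ j, ‖z j‖ ≤ m * x j := fun j => (div_le_iff₀ (hx j)).1 (hi j (mem_univ j))
  have hzi : ‖z i‖ = m * x i := (div_mul_cancel₀ _ (hx i).ne').symm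
  have hzp : 0 < ‖z i‖ ^ (r - 1) := pow_pos (hzi ▸ mul_pos hm (hx i)) _
  refine le_of_mul_le_mul_right ?_ hzp
  calc ‖a‖ * ‖z i‖ ^ (r - 1) = ‖∑ e ∈ E.filter (i ∈ ·), ∏ j ∈ e.erase i, z j‖ := by
        rw [hza, norm_mul, norm_pow]
    _ ≤ ∑ e ∈ E.filter (i ∈ ·), ∏ j ∈ e.erase i, (m * x j) := by
        refine (norm_sum_le _ _).trans (sum_le_sum fun e _ => ?_)
        rw [norm_prod]
        exact prod_le_prod (fun j _ => norm_nonneg _) fun j _ => hle j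
    _ = m ^ (r - 1) * ∑ e ∈ E.filter (i ∈ ·), ∏ j ∈ e.erase i, x j := by
        rw [mul_sum]
        refine sum_congr rfl fun e he => ?_
        rw [mem_filter] at he
        rw [prod_mul_distrib, prod_const, card_erase_of_mem he.2, hu e he.1]
    _ = c * ‖z i‖ ^ (r - 1) := by
        rw [hxc, hzi, mul_pow]
        ring

/-! ### Passage to finite families on the vertex subtype. -/

namespace Hypergraph

variable {α : Type*}

open Classical in
/-- The edges of a finite hypergraph as finite sets of elements of the vertex subtype. -/
noncomputable def subtypeEdges (H : Hypergraph α) [Fintype V(H)] : Finset (Finset V(H)) :=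
  Finset.univ.filter fun s => Subtype.val '' (s : Set V(H)) ∈ E(H)

theorem mem_subtypeEdges {H : Hypergraph α} [Fintype V(H)] {s : Finset V(H)} :
    s ∈ H.subtypeEdges ↔ Subtype.val '' (s : Set V(H)) ∈ E(H) := by
  simp [subtypeEdges]

/-- A finite set of vertices, seen as a set in the ambient type. -/
def coeFinset (H : Hypergraph α) : Finset V(H) ↪ Set α where
  toFun s := Subtype.val '' (s : Set V(H))
  inj' _ _ h := Finset.coe_injective (Subtype.val_injective.image_injective h)

theorem exists_coeFinset_eq {H : Hypergraph α} [Fintype V(H)] {e : Set α} (he : e ∈ E(H)) :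
    ∃ s ∈ H.subtypeEdges, H.coeFinset s = e := by
  classical
  have : H.coeFinset (Finset.univ.filter fun x : V(H) => (x : α) ∈ e) = e := by
    ext x
    constructor
    · rintro ⟨y, hy, rfl⟩
      exact (Finset.mem_filter.1 hy).2
    · exact fun h => ⟨⟨x, mem_vertexSet_of_mem_edgeSet he h⟩,
        Finset.mem_filter.2 ⟨Finset.mem_univ _, h⟩, rfl⟩
  exact ⟨_, mem_subtypeEdges.2 (by rwa [← this] at he), this⟩

theorem image_coeFinset_subtypeEdges (H : Hypergraph α) [Fintype V(H)] :
    H.coeFinset '' (H.subtypeEdges : Set (Finset V(H))) = E(H) := by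
  ext e
  constructor
  · rintro ⟨s, hs, rfl⟩
    exact mem_subtypeEdges.1 hs
  · exact fun he => exists_coeFinset_eq he

theorem card_subtypeEdges (H : Hypergraph α) [Fintype V(H)] :
    H.subtypeEdges.card = E(H).ncard := by
  rw [← image_coeFinset_subtypeEdges, Set.ncard_image_of_injective _ H.coeFinset.injective,
    Set.ncard_coe_finset]

theorem IsUniform.card_eq {H : Hypergraph α} [Fintype V(H)] {r : ℕ} (hu : H.IsUniform r) :
    ∀ s ∈ H.subtypeEdges, s.card = r := by
  intro s hs
  have := hu _ (mem_subtypeEdges.1 hs)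
  rw [Subtype.val_injective.encard_image, Set.encard_coe_eq_coe_finsetCard] at this
  exact_mod_cast this

theorem exists_adj_crossing {H : Hypergraph α} {x y : α} (h : Relation.ReflTransGen H.Adj x y)
    {U : Set α} (hx : x ∈ U) (hy : y ∉ U) : ∃ a ∈ U, ∃ b ∉ U, H.Adj a b := by
  induction h with
  | refl => exact absurd hx hy
  | @tail b c _ hbc ih =>
    by_cases hb : b ∈ U
    · exact ⟨b, hb, c, hy, hbc⟩
    · exact ih hb

/-- Connectedness in cut form, as needed by the counting argument and by the positivity of the
Perron vector. -/
theorem IsConnected.exists_edge_crossing {H : Hypergraph α} [Fintype V(H)] (hc : H.IsConnected)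
    (U : Finset V(H)) (hU : U.Nonempty) (hU' : U ≠ Finset.univ) :
    ∃ e ∈ H.subtypeEdges, ∃ x ∈ e, x ∈ U ∧ ∃ y ∈ e, y ∉ U := by
  obtain ⟨x, hx⟩ := hU
  obtain ⟨y, hy⟩ : ∃ y, y ∉ U := by
    by_contra! h
    exact hU' (Finset.eq_univ_of_forall h)
  obtain ⟨a, ⟨a, ha, rfl⟩, b, hb, e, he, hae, hbe⟩ :=
    exists_adj_crossing (hc.2 x x.2 y y.2) (U := Subtype.val '' (U : Set V(H)))
      ⟨x, hx, rfl⟩ (by rintro ⟨z, hz, hzy⟩; exact hy (Subtype.ext hzy ▸ hz))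
  obtain ⟨s, hs, rfl⟩ := exists_coeFinset_eq he
  obtain ⟨a', ha', haa⟩ := hae
  obtain ⟨b', hb', rfl⟩ := hbe
  refine ⟨s, hs, a', ha', ?_, b', hb', fun h => hb ⟨b', h, rfl⟩⟩
  rw [Subtype.ext haa]
  exact ha

/-- A finite acyclic uniform hypergraph with a vertex has few edges. -/
theorem IsAcyclic.mul_ncard_lt {H : Hypergraph α} {r : ℕ} (hr : 0 < r) (hf : V(H).Finite)
    (hne : V(H).Nonempty) (hu : H.IsUniform r) (ha : H.IsAcyclic) :
    (r - 1) * E(H).ncard < V(H).ncard := by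
  classical
  have := hf.fintype
  rw [← card_subtypeEdges, ← Nat.card_coe_set_eq, Nat.card_eq_fintype_card]
  by_contra! hle
  rcases H.subtypeEdges.eq_empty_or_nonempty with h0 | h0
  · have := hne.to_subtype
    have := Fintype.card_pos (α := V(H))
    rw [h0, Finset.card_empty, mul_zero] at hle
    omega
  · obtain ⟨l, v, e, hv, he, h⟩ := exists_cycle_of_card_biUnion_le hr H.subtypeEdges h0 hu.card_eq
      ((Finset.card_le_univ _).trans hle)
    exact ha ⟨l, fun i => v i, fun i => H.coeFinset (e i), Subtype.val_injective.comp hv,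
      H.coeFinset.injective.comp he, fun i => ⟨mem_subtypeEdges.1 (h i).1,
        ⟨_, (h i).2.1, rfl⟩, ⟨_, (h i).2.2, rfl⟩⟩⟩

/-- A finite connected uniform hypergraph with few edges is acyclic. -/
theorem IsConnected.isAcyclic {H : Hypergraph α} {r : ℕ} (hf : V(H).Finite)
    (hu : H.IsUniform r) (hc : H.IsConnected) (hcard : (r - 1) * E(H).ncard < V(H).ncard) :
    H.IsAcyclic := by
  classical
  have := hf.fintype
  rw [← card_subtypeEdges, ← Nat.card_coe_set_eq, Nat.card_eq_fintype_card] at hcard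
  rintro ⟨l, v, e, hv, he, h⟩
  choose s hs hse using fun i => exists_coeFinset_eq (h i).1
  have hmem : ∀ i x (hx : x ∈ e i), ⟨x, mem_vertexSet_of_mem_edgeSet (h i).1 hx⟩ ∈ s i := by
    intro i x hx
    rw [← hse i] at hx
    obtain ⟨y, hy, rfl⟩ := hx
    exact hy
  refine hcard.not_ge (card_le_of_cycle H.subtypeEdges hu.card_eq hc.exists_edge_crossing
    (v := fun i => ⟨v i, mem_vertexSet_of_mem_edgeSet (h i).1 (h i).2.1⟩) (e := s)
    (fun i j hij => hv (congrArg Subtype.val hij)) (fun i j hij => he ?_)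
    fun i => ⟨hs i, hmem i _ (h i).2.1, hmem i _ (h i).2.2⟩)
  rw [← hse, ← hse, hij]

/-! ### The adjacency tensor and its spectral radius. -/

-- This count cancels the factor `1 / (r - 1)!` of the adjacency tensor.
open Finset in
theorem card_functions_onto {ι : Type*} [DecidableEq ι] [Fintype ι] {n : ℕ} {s : Finset ι}
    (hs : #s = n) : #((univ : Finset (Fin n → ι)).filter fun f => univ.image f = s) =
      n.factorial := by
  have h : ((univ : Finset (Fin n → ι)).filter fun f => univ.image f = s) =
      (univ : Finset (Fin n ≃ s)).image fun σ i => (σ i : ι) := by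
    ext f
    simp only [mem_filter, mem_univ, true_and, mem_image]
    constructor
    · rintro hf
      have hmem : ∀ i, f i ∈ s := fun i => hf ▸ mem_image_of_mem f (mem_univ i)
      have hbij : Function.Bijective fun i => (⟨f i, hmem i⟩ : s) := by
        refine (Fintype.bijective_iff_surjective_and_card _).2 ⟨?_, by simp [hs]⟩
        rintro ⟨x, hx⟩
        rw [← hf] at hx
        obtain ⟨i, -, rfl⟩ := mem_image.1 hx
        exact ⟨i, rfl⟩
      exact ⟨Equiv.ofBijective _ hbij, rfl⟩
    · rintro ⟨σ, rfl⟩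
      ext x
      simp only [mem_image, mem_univ, true_and]
      constructor
      · rintro ⟨i, rfl⟩
        exact (σ i).2
      · exact fun hx => ⟨σ.symm ⟨x, hx⟩, by simp⟩
  rw [h, card_image_of_injective, card_univ, Fintype.card_equiv (Fintype.equivOfCardEq
    (by simp [hs])), Fintype.card_fin]
  intro σ τ hστ
  ext i
  exact congrFun hστ i

open Finset in
theorem image_eq_erase {ι : Type*} [DecidableEq ι] {n : ℕ} {e : Finset ι} (he : #e = n + 1)
    {i : ι} (f : Fin n → ι) : insert i (univ.image f) = e ↔ i ∈ e ∧ univ.image f = e.erase i := by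
  constructor
  · rintro rfl
    refine ⟨mem_insert_self _ _, ?_⟩
    rw [erase_insert]
    intro hi
    rw [insert_eq_of_mem hi] at he
    have : #(univ.image f) ≤ n := card_image_le.trans (by simp)
    omega
  · rintro ⟨hi, hf⟩
    rw [hf, insert_erase hi]

open Finset in
/-- The adjacency tensor acts by summing over edges the product over the other vertices. -/
theorem adjacencyTensor_apply {H : Hypergraph α} [Fintype V(H)] [DecidableEq V(H)] {r : ℕ}
    (hr : 0 < r) (hu : H.IsUniform r) (z : V(H) → ℂ) (i : V(H)) :
    (H.adjacencyTensor r).apply z i =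
      ∑ e ∈ H.subtypeEdges.filter (i ∈ ·), ∏ j ∈ e.erase i, z j := by
  rw [Tensor.apply, finsum_eq_sum_of_fintype]
  -- At most one edge meets the condition for a given `f`, so the right side has at most one nonzero
  -- term.
  have hterm : ∀ f : Fin (r - 1) → V(H), (H.adjacencyTensor r i f : ℂ) * ∏ j, z (f j) =
      ∑ e ∈ H.subtypeEdges.filter (i ∈ ·), if univ.image f = e.erase i then
        ((1 / ((r - 1).factorial : ℝ) : ℝ) : ℂ) * ∏ j ∈ e.erase i, z j else 0 := by
    intro f
    have hset : insert (i : α) (Set.range fun j => (f j : α)) =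
        Subtype.val '' ((insert i (univ.image f) : Finset V(H)) : Set V(H)) := by
      rw [coe_insert, coe_image, coe_univ, Set.image_univ, Set.image_insert_eq, ← Set.range_comp]
      rfl
    rw [adjacencyTensor, hset]
    simp only [← mem_subtypeEdges]
    by_cases hmem : insert i (univ.image f) ∈ H.subtypeEdges
    · set e := insert i (univ.image f) with he
      have hcard : #e = (r - 1) + 1 := by rw [hu.card_eq _ hmem]; omega
      obtain ⟨hie, himg⟩ := (image_eq_erase hcard f).1 he.symm
      rw [if_pos hmem, sum_eq_single_of_mem e (mem_filter.2 ⟨hmem, hie⟩), if_pos himg]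
      · congr 1
        have hinj : Set.InjOn f (univ : Finset (Fin (r - 1))) := by
          refine card_image_iff.1 ?_
          rw [himg, card_erase_of_mem hie, hcard]
          simp
        rw [← himg, prod_image hinj]
      · intro e' he' hne
        rw [mem_filter] at he'
        refine if_neg fun h => hne ?_
        rw [he, h, insert_erase he'.2]
    · rw [if_neg hmem]
      simp only [Complex.ofReal_zero, zero_mul]
      symm
      refine sum_eq_zero fun e he => if_neg fun h => hmem ?_
      rw [mem_filter] at he
      rw [h, insert_erase he.2]
      exact he.1
  rw [sum_congr rfl fun f _ => hterm f, sum_comm]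
  refine sum_congr rfl fun e he => ?_
  rw [mem_filter] at he
  rw [← sum_filter, sum_const, card_functions_onto (by
    rw [card_erase_of_mem he.2, hu.card_eq e he.1]), nsmul_eq_mul, ← mul_assoc]
  push_cast
  rw [mul_one_div_cancel (by exact_mod_cast (r - 1).factorial_ne_zero), one_mul]

open Finset in
/-- The spectral radius of a finite connected uniform hypergraph has a positive eigenvector. -/
theorem IsConnected.exists_pos_eigenvector {H : Hypergraph α} [Fintype V(H)] [DecidableEq V(H)]
    {r : ℕ} (hr : 0 < r) (hu : H.IsUniform r) (hc : H.IsConnected) :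
    ∃ x : V(H) → ℝ, (∀ i, 0 < x i) ∧ ∀ i, ∑ e ∈ H.subtypeEdges.filter (i ∈ ·),
      ∏ j ∈ e.erase i, x j = H.spectralRadius r * x i ^ (r - 1) := by
  have := hc.1.to_subtype
  obtain ⟨x, c, hx, hc0, hxc⟩ :=
    exists_perron_vector hr H.subtypeEdges hu.card_eq hc.exists_edge_crossing
  have hgreat : IsGreatest {t : ℝ | ∃ c : ℂ, (H.adjacencyTensor r).IsEigenvalue c ∧ t = ‖c‖} c := by
    constructor
    · refine ⟨c, ⟨fun i => x i, fun h => ?_, fun i => ?_⟩, by simp [abs_of_nonneg hc0]⟩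
      · obtain ⟨a⟩ := this
        exact (hx a).ne' (Complex.ofReal_eq_zero.1 (congrFun h a))
      · rw [adjacencyTensor_apply hr hu]
        have := congrArg Complex.ofReal (hxc i)
        push_cast at this
        exact this
    · rintro _ ⟨a, ⟨z, hz, hza⟩, rfl⟩
      refine norm_eigenvalue_le H.subtypeEdges hu.card_eq hx hxc hz fun i => ?_
      rw [← adjacencyTensor_apply hr hu, hza]
  refine ⟨x, hx, ?_⟩
  rw [spectralRadius, Tensor.spectralRadius, hgreat.csSup_eq]
  exact hxc

/-! ### The spectral radius as the largest root of the matching polynomial. -/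

theorem disjoint_coeFinset {H : Hypergraph α} {s t : Finset V(H)} :
    Disjoint (H.coeFinset s) (H.coeFinset t) ↔ Disjoint s t := by
  rw [← Finset.disjoint_coe]
  exact Set.disjoint_image_iff Subtype.val_injective

open Finset in
theorem matchingCount_eq_card (H : Hypergraph α) [Fintype V(H)] (k : ℕ) :
    H.matchingCount k = #((matchings H.subtypeEdges).filter (#· = k)) := by
  classical
  have himg : {M : Finset (Set α) | (M : Set (Set α)) ⊆ E(H) ∧
      (M : Set (Set α)).PairwiseDisjoint id ∧ M.card = k} =
      (fun N : Finset (Finset V(H)) => N.map H.coeFinset) ''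
        ((matchings H.subtypeEdges).filter (#· = k) : Finset (Finset (Finset V(H)))) := by
    ext M
    simp only [Set.mem_ofPred_eq, Set.mem_image, coe_filter, mem_matchings]
    constructor
    · rintro ⟨hM, hd, hk⟩
      have hN : (H.subtypeEdges.filter fun s => H.coeFinset s ∈ M).map H.coeFinset = M := by
        ext e
        simp only [mem_map, mem_filter]
        constructor
        · rintro ⟨s, hs, rfl⟩
          exact hs.2
        · intro he
          obtain ⟨s, hs, rfl⟩ := exists_coeFinset_eq (hM he)
          exact ⟨s, ⟨hs, he⟩, rfl⟩
      refine ⟨_, ⟨⟨filter_subset _ _, fun s hs t ht hst => ?_⟩, ?_⟩, hN⟩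
      · exact disjoint_coeFinset.1 (hd (mem_filter.1 hs).2 (mem_filter.1 ht).2
          (H.coeFinset.injective.ne hst))
      · rw [← hk, ← card_map H.coeFinset, hN]
    · rintro ⟨N, ⟨⟨hN, hd⟩, hk⟩, rfl⟩
      refine ⟨?_, ?_, by rw [card_map, hk]⟩
      · rw [coe_map, ← image_coeFinset_subtypeEdges]
        exact Set.image_mono hN
      · rw [coe_map]
        rintro _ ⟨s, hs, rfl⟩ _ ⟨t, ht, rfl⟩ hst
        exact disjoint_coeFinset.2 (hd hs ht fun h => hst (by rw [h]))
  rw [matchingCount, himg, Set.ncard_image_of_injective _ (map_injective _), Set.ncard_coe_finset]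

open Finset in
theorem card_mul_le_of_mem_matchings {H : Hypergraph α} [Fintype V(H)] {r : ℕ}
    (hu : H.IsUniform r) {M : Finset (Finset V(H))} (hM : M ∈ matchings H.subtypeEdges) :
    #M * r ≤ V(H).ncard := by
  classical
  obtain ⟨hME, hMd⟩ := mem_matchings.1 hM
  rw [← Nat.card_coe_set_eq, Nat.card_eq_fintype_card, ← sum_const_nat fun e he =>
    hu.card_eq e (hME he)]
  rw [← card_biUnion (t := fun e => e) fun e he f hf hne => hMd he hf hne]
  exact card_le_univ _

open Finset in
theorem aeval_matchingPoly {H : Hypergraph α} [Fintype V(H)] {r : ℕ} (hr : 0 < r)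
    (hu : H.IsUniform r) (t : ℝ) : Polynomial.aeval t (H.matchingPoly r) =
      ∑ M ∈ matchings H.subtypeEdges, (-1) ^ #M * t ^ (Fintype.card V(H) - #M * r) := by
  have hn : V(H).ncard = Fintype.card V(H) := by
    rw [← Nat.card_coe_set_eq, Nat.card_eq_fintype_card]
  have hmaps : ∀ M ∈ matchings H.subtypeEdges, #M ∈ range (V(H).ncard + 1) := by
    intro M hM
    have h1 := card_mul_le_of_mem_matchings hu hM
    have h2 := Nat.le_mul_of_pos_right #M hr
    rw [mem_range]
    omega
  rw [← sum_fiberwise_of_maps_to hmaps, matchingPoly, map_sum]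
  refine sum_congr rfl fun k _ => ?_
  rw [matchingCount_eq_card, sum_congr rfl fun M hM => by rw [(mem_filter.1 hM).2], sum_const,
    hn, nsmul_eq_mul]
  simp
  ring

/-- The spectral radius of a uniform supertree is the largest real root of its matching
polynomial. -/
theorem IsSupertree.isGreatest_roots {H : Hypergraph α} {r : ℕ} (hr : 0 < r)
    (hH : H.IsSupertree) (hu : H.IsUniform r) :
    IsGreatest {t : ℝ | Polynomial.aeval t (H.matchingPoly r) = 0} (H.spectralRadius r) := by
  classical
  have := hH.finite.fintype
  obtain ⟨x, hx, hxc⟩ := hH.connected.exists_pos_eigenvector hr hu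
  -- Multiplying the eigenvalue equation by `x i` turns it into one between full edge products.
  have hx' : ∀ i, H.spectralRadius r * x i ^ r =
      ∑ e ∈ H.subtypeEdges.filter (i ∈ ·), ∏ j ∈ e, x j := by
    intro i
    rw [← Nat.sub_add_cancel hr, pow_succ, ← mul_assoc, Nat.sub_add_cancel hr, ← hxc,
      Finset.sum_mul]
    exact Finset.sum_congr rfl fun e he => Finset.prod_erase_mul _ _ (Finset.mem_filter.1 he).2
  constructor
  · rw [Set.mem_ofPred_eq, aeval_matchingPoly hr hu]
    refine matchingSum_eq_zero _ hu.card_eq ?_ hx hx'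
    have := hH.acyclic.mul_ncard_lt hr hH.finite hH.connected.1 hu
    rwa [← card_subtypeEdges, ← Nat.card_coe_set_eq V(H), Nat.card_eq_fintype_card] at this
  · intro t ht
    by_contra! hlt
    rw [Set.mem_ofPred_eq, aeval_matchingPoly hr hu] at ht
    exact (matchingSum_pos hr _ hu.card_eq hx hx' hlt).ne' ht

/-! ### Matching numbers and their generating polynomial. -/

variable {β γ : Type*}

theorem finite_edgeSet {H : Hypergraph α} (hf : V(H).Finite) : E(H).Finite :=
  hf.finite_subsets.subset fun _ he => he.subset_vertexSet

theorem matchingCount_eq_zero {H : Hypergraph α} {r : ℕ} (hf : V(H).Finite) (hu : H.IsUniform r)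
    {k : ℕ} (hk : V(H).ncard < k * r) : H.matchingCount k = 0 := by
  have := hf.fintype
  rw [matchingCount_eq_card, Finset.card_eq_zero, Finset.filter_eq_empty_iff]
  rintro M hM rfl
  exact hk.not_ge (card_mul_le_of_mem_matchings hu hM)

open Polynomial in
theorem coeff_matchingPoly {H : Hypergraph α} {r : ℕ} (hr : 0 < r) (hf : V(H).Finite)
    (hu : H.IsUniform r) {k : ℕ} (hk : k * r ≤ V(H).ncard) :
    (H.matchingPoly r).coeff (V(H).ncard - k * r) = (-1) ^ k * (H.matchingCount k : ℤ) := by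
  rw [matchingPoly, finsetSum_coeff]
  have hkn := Nat.le_mul_of_pos_right k hr
  rw [Finset.sum_eq_single_of_mem k (Finset.mem_range.2 (by omega))]
  · rw [coeff_C_mul_X_pow, if_pos rfl]
  · intro j _ hj
    rw [coeff_C_mul_X_pow]
    -- Truncated subtraction lets exponents collide for `j ≠ k` only if `j * r` exceeds the order,
    -- and then the matching number is zero.
    split_ifs with h
    · by_cases hjn : V(H).ncard < j * r
      · rw [matchingCount_eq_zero hf hu hjn, Nat.cast_zero, mul_zero]
      · exact absurd (Nat.eq_of_mul_eq_mul_right hr (by omega)) hj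
    · rfl

/-- The matching polynomial and the number of vertices determine the matching numbers. -/
theorem matchingCount_eq_of_matchingPoly_eq {G : Hypergraph α} {H : Hypergraph β} {r : ℕ}
    (hr : 0 < r) (hGf : V(G).Finite) (hHf : V(H).Finite) (hGr : G.IsUniform r)
    (hHr : H.IsUniform r) (hcard : V(G).ncard = V(H).ncard)
    (hφ : G.matchingPoly r = H.matchingPoly r) (k : ℕ) :
    G.matchingCount k = H.matchingCount k := by
  by_cases hk : k * r ≤ V(G).ncard
  · have h1 := coeff_matchingPoly hr hGf hGr hk
    have h2 := coeff_matchingPoly hr hHf hHr (hcard ▸ hk)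
    rw [hφ, hcard, h2] at h1
    exact_mod_cast (mul_left_cancel₀ (pow_ne_zero k (by norm_num)) h1).symm
  · push Not at hk
    rw [matchingCount_eq_zero hGf hGr hk, matchingCount_eq_zero hHf hHr (hcard ▸ hk)]

open Classical in
/-- The sets of pairwise disjoint edges (empty by convention if there are infinitely many). -/
noncomputable def edgeMatchings (H : Hypergraph α) : Finset (Finset (Set α)) :=
  if h : E(H).Finite then
    h.toFinset.powerset.filter fun M => (M : Set (Set α)).PairwiseDisjoint id
  else ∅

theorem mem_edgeMatchings {H : Hypergraph α} (hf : V(H).Finite) {M : Finset (Set α)} :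
    M ∈ H.edgeMatchings ↔ (M : Set (Set α)) ⊆ E(H) ∧ (M : Set (Set α)).PairwiseDisjoint id := by
  simp [edgeMatchings, finite_edgeSet hf, Set.subset_def, Finset.subset_iff]

open Polynomial in
/-- The generating polynomial of the matching numbers. -/
noncomputable def matchingGen (H : Hypergraph α) : ℤ[X] := ∑ M ∈ H.edgeMatchings, X ^ M.card

theorem coeff_matchingGen {H : Hypergraph α} (hf : V(H).Finite) (k : ℕ) :
    H.matchingGen.coeff k = H.matchingCount k := by
  have hset : {M : Finset (Set α) | (M : Set (Set α)) ⊆ E(H) ∧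
      (M : Set (Set α)).PairwiseDisjoint id ∧ M.card = k} =
      (H.edgeMatchings.filter (k = ·.card) : Finset (Finset (Set α))) := by
    ext M
    simp [mem_edgeMatchings hf, and_assoc, eq_comm]
  rw [matchingCount, hset, Set.ncard_coe_finset, matchingGen, Polynomial.finsetSum_coeff]
  simp [Polynomial.coeff_X_pow]

theorem matchingGen_eq_iff {G : Hypergraph α} {H : Hypergraph β} (hGf : V(G).Finite)
    (hHf : V(H).Finite) :
    G.matchingGen = H.matchingGen ↔ ∀ k, G.matchingCount k = H.matchingCount k := by
  rw [Polynomial.ext_iff]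
  simp only [coeff_matchingGen hGf, coeff_matchingGen hHf, Nat.cast_inj]

theorem IsUniform.deleteVertex {H : Hypergraph α} {r : ℕ} (hu : H.IsUniform r) (v : α) :
    (H.deleteVertex v).IsUniform r := fun e he => hu e he.1

theorem finite_deleteVertex {H : Hypergraph α} (hf : V(H).Finite) (v : α) :
    V(H.deleteVertex v).Finite := hf.subset Set.sdiff_subset

open Classical in
theorem edgeMatchings_deleteVertex {H : Hypergraph α} (hf : V(H).Finite) (v : α) :
    (H.deleteVertex v).edgeMatchings = H.edgeMatchings.filter fun M => ¬ ∃ e ∈ M, v ∈ e := by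
  ext M
  rw [mem_edgeMatchings (finite_deleteVertex hf v), Finset.mem_filter, mem_edgeMatchings hf]
  constructor
  · rintro ⟨h1, h2⟩
    exact ⟨⟨fun e he => (h1 he).1, h2⟩, fun ⟨e, he, hv⟩ => (h1 he).2 hv⟩
  · rintro ⟨⟨h1, h2⟩, h3⟩
    exact ⟨fun e he => ⟨h1 he, fun hv => h3 ⟨e, he, hv⟩⟩, h2⟩

/-! ### Coalescence of two hypergraphs. -/

theorem glueMap_injective (u : α) (w : β) : Function.Injective (glueMap u w) := by
  intro x y h
  unfold glueMap at h
  split_ifs at h with h1 h2 h2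
  · rw [h1, h2]
  · exact Sum.inr_injective h

theorem glueMap_self (u : α) (w : β) : glueMap u w w = Sum.inl u := if_pos rfl

theorem inl_eq_glueMap {u x : α} {w y : β} : Sum.inl x = glueMap u w y ↔ x = u ∧ y = w := by
  unfold glueMap
  split_ifs with h <;> simp [h]

theorem vertexSet_glue (G : Hypergraph α) (u : α) (K : Hypergraph β) (w : β) :
    V(G.glue u K w) = Sum.inl '' V(G) ∪ glueMap u w '' V(K) := rfl

theorem edgeSet_glue (G : Hypergraph α) (u : α) (K : Hypergraph β) (w : β) :
    E(G.glue u K w) = Set.image Sum.inl '' E(G) ∪ Set.image (glueMap u w) '' E(K) := rfl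

theorem finite_glue {G : Hypergraph α} {K : Hypergraph β} (hG : V(G).Finite) (hK : V(K).Finite)
    (u : α) (w : β) : V(G.glue u K w).Finite :=
  (hG.image _).union (hK.image _)

theorem ncard_vertexSet_glue {G : Hypergraph α} {K : Hypergraph β} (hG : V(G).Finite)
    (hK : V(K).Finite) {u : α} {w : β} (hu : u ∈ V(G)) (hw : w ∈ V(K)) :
    V(G.glue u K w).ncard + 1 = V(G).ncard + V(K).ncard := by
  have hinter : Sum.inl '' V(G) ∩ glueMap u w '' V(K) = {Sum.inl u} := by
    ext p
    constructor
    · rintro ⟨⟨x, -, rfl⟩, y, -, hy⟩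
      rw [(inl_eq_glueMap.1 hy.symm).1]
      rfl
    · rintro rfl
      exact ⟨⟨u, hu, rfl⟩, w, hw, glueMap_self u w⟩
  have h := Set.ncard_union_add_ncard_inter (Sum.inl '' V(G)) (glueMap u w '' V(K))
    (hG.image _) (hK.image _)
  rwa [hinter, Set.ncard_singleton, Set.ncard_image_of_injective _ Sum.inl_injective,
    Set.ncard_image_of_injective _ (glueMap_injective u w)] at h

theorem disjoint_inl_glueMap {u : α} {w : β} {e : Set α} {f : Set β} :
    Disjoint (Sum.inl '' e) (glueMap u w '' f) ↔ ¬ (u ∈ e ∧ w ∈ f) := by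
  rw [Set.disjoint_left]
  constructor
  · rintro h ⟨hu, hw⟩
    exact h ⟨u, hu, rfl⟩ ⟨w, hw, glueMap_self u w⟩
  · rintro h _ ⟨x, hx, rfl⟩ ⟨y, hy, hxy⟩
    obtain ⟨rfl, rfl⟩ := inl_eq_glueMap.1 hxy.symm
    exact h ⟨hx, hy⟩

/-- An edge with two vertices has one other than `w`, which lands outside the left copy. So edges of
the two parts never coincide and their numbers add. -/
theorem image_inl_ne_image_glueMap (u : α) (w : β) (e : Set α) {f : Set β} (hf : 1 < f.encard) :
    Sum.inl '' e ≠ glueMap u w '' f := by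
  intro h
  obtain ⟨y, hy, hyw⟩ := Set.exists_ne_of_one_lt_encard hf w
  obtain ⟨x, -, hx⟩ : glueMap u w y ∈ Sum.inl '' e := h ▸ Set.mem_image_of_mem _ hy
  exact hyw (inl_eq_glueMap.1 hx).2

theorem IsUniform.one_lt_encard {H : Hypergraph α} {r : ℕ} (hr : 1 < r) (hu : H.IsUniform r)
    {e : Set α} (he : e ∈ E(H)) : 1 < e.encard := by
  rw [hu e he]
  exact_mod_cast hr

theorem ncard_edgeSet_glue {G : Hypergraph α} {K : Hypergraph β} {r : ℕ} (hr : 1 < r)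
    (hG : V(G).Finite) (hK : V(K).Finite) (hKr : K.IsUniform r) (u : α) (w : β) :
    E(G.glue u K w).ncard = E(G).ncard + E(K).ncard := by
  rw [edgeSet_glue, Set.ncard_union_eq ?_ ((finite_edgeSet hG).image _)
    ((finite_edgeSet hK).image _), Set.ncard_image_of_injective _ Sum.inl_injective.image_injective,
    Set.ncard_image_of_injective _ (glueMap_injective u w).image_injective]
  rw [Set.disjoint_left]
  rintro _ ⟨e, -, rfl⟩ ⟨f, hf, h⟩
  exact image_inl_ne_image_glueMap u w e (hKr.one_lt_encard hr hf) h.symm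

theorem IsUniform.glue {G : Hypergraph α} {K : Hypergraph β} {r : ℕ} (hG : G.IsUniform r)
    (hK : K.IsUniform r) (u : α) (w : β) : (G.glue u K w).IsUniform r := by
  rintro _ (⟨e, he, rfl⟩ | ⟨e, he, rfl⟩)
  · rw [Sum.inl_injective.encard_image, hG e he]
  · rw [(glueMap_injective u w).encard_image, hK e he]

theorem IsConnected.glue {G : Hypergraph α} {K : Hypergraph β} (hG : G.IsConnected)
    (hK : K.IsConnected) {u : α} {w : β} (hu : u ∈ V(G)) (hw : w ∈ V(K)) :
    (G.glue u K w).IsConnected := by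
  have hl : ∀ x ∈ V(G), ∀ y ∈ V(G),
      Relation.ReflTransGen (G.glue u K w).Adj (Sum.inl x) (Sum.inl y) := fun x hx y hy =>
    (hG.2 x hx y hy).lift Sum.inl fun a b ⟨e, he, ha, hb⟩ =>
      ⟨Sum.inl '' e, Or.inl ⟨e, he, rfl⟩, ⟨a, ha, rfl⟩, ⟨b, hb, rfl⟩⟩
  have hm : ∀ x ∈ V(K), ∀ y ∈ V(K),
      Relation.ReflTransGen (G.glue u K w).Adj (glueMap u w x) (glueMap u w y) :=
    fun x hx y hy => (hK.2 x hx y hy).lift (glueMap u w) fun a b ⟨e, he, ha, hb⟩ =>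
      ⟨glueMap u w '' e, Or.inr ⟨e, he, rfl⟩, ⟨a, ha, rfl⟩, ⟨b, hb, rfl⟩⟩
  have hself := glueMap_self u w
  refine ⟨⟨_, Or.inl ⟨u, hu, rfl⟩⟩, ?_⟩
  rintro _ (⟨x, hx, rfl⟩ | ⟨x, hx, rfl⟩) _ (⟨y, hy, rfl⟩ | ⟨y, hy, rfl⟩)
  · exact hl x hx y hy
  · exact (hl x hx u hu).trans (hself ▸ hm w hw y hy)
  · exact Relation.ReflTransGen.trans (hself ▸ hm x hx w hw) (hl u hu y hy)
  · exact hm x hx y hy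

/-- The coalescence of two uniform supertrees is a supertree. -/
theorem IsSupertree.glue {G : Hypergraph α} {K : Hypergraph β} {r : ℕ} (hr : 1 < r)
    (hG : G.IsSupertree) (hGr : G.IsUniform r) (hK : K.IsSupertree) (hKr : K.IsUniform r)
    {u : α} {w : β} (hu : u ∈ V(G)) (hw : w ∈ V(K)) : (G.glue u K w).IsSupertree := by
  have hf := finite_glue hG.finite hK.finite u w
  have hc := hG.connected.glue hK.connected hu hw
  -- No cycle is analysed: edge counts add and the orders overlap in one vertex, so the strict
  -- inequalities of the parts give the one for the whole.
  refine ⟨hf, hc, hc.isAcyclic hf (hGr.glue hKr u w) ?_⟩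
  have h1 := hG.acyclic.mul_ncard_lt (by omega) hG.finite hG.connected.1 hGr
  have h2 := hK.acyclic.mul_ncard_lt (by omega) hK.finite hK.connected.1 hKr
  have h3 := ncard_vertexSet_glue hG.finite hK.finite hu hw
  rw [ncard_edgeSet_glue hr hG.finite hK.finite hKr, mul_add]
  omega

open Polynomial Classical in
/-- The matching generating polynomial of a coalescence. -/
theorem matchingGen_glue {G : Hypergraph α} {K : Hypergraph β} {r : ℕ} (hr : 1 < r)
    (hG : V(G).Finite) (hK : V(K).Finite) (hKr : K.IsUniform r) (u : α) (w : β) :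
    (G.glue u K w).matchingGen = G.matchingGen * (K.deleteVertex w).matchingGen +
      (G.deleteVertex u).matchingGen * (K.matchingGen - (K.deleteVertex w).matchingGen) := by
  let F : Set α ↪ Set (α ⊕ β) := ⟨Set.image Sum.inl, Sum.inl_injective.image_injective⟩
  let F' : Set β ↪ Set (α ⊕ β) :=
    ⟨Set.image (glueMap u w), (glueMap_injective u w).image_injective⟩
  have hne : ∀ e, ∀ f ∈ E(K), F e ≠ F' f := fun e f hf =>
    image_inl_ne_image_glueMap u w e (hKr.one_lt_encard hr hf)
  have hpairs : (G.glue u K w).matchingGen = ∑ p ∈ (G.edgeMatchings ×ˢ K.edgeMatchings).filter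
      (fun p => ¬ ((∃ e ∈ p.1, u ∈ e) ∧ ∃ f ∈ p.2, w ∈ f)), X ^ (p.1.card + p.2.card) := by
    rw [matchingGen]
    symm
    refine Finset.sum_nbij (fun p => p.1.map F ∪ p.2.map F') ?_ ?_ ?_ ?_
    · rintro ⟨M, N⟩ hp
      simp only [Finset.mem_filter, Finset.mem_product, mem_edgeMatchings hG,
        mem_edgeMatchings hK] at hp
      obtain ⟨⟨⟨hM, hMd⟩, hN, hNd⟩, hMN⟩ := hp
      rw [mem_edgeMatchings (finite_glue hG hK u w)]
      have hcross : ∀ e ∈ M, ∀ f ∈ N, Disjoint (F e) (F' f) := fun e he f hf =>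
        disjoint_inl_glueMap.2 fun h => hMN ⟨⟨e, he, h.1⟩, f, hf, h.2⟩
      simp only [Finset.coe_union, Finset.coe_map]
      refine ⟨Set.union_subset_union (Set.image_mono hM) (Set.image_mono hN), ?_⟩
      rintro _ (⟨e, he, rfl⟩ | ⟨e, he, rfl⟩) _ (⟨f, hf, rfl⟩ | ⟨f, hf, rfl⟩) hef
      · exact (Set.disjoint_image_iff Sum.inl_injective).2 (hMd he hf fun h => hef (by rw [h]))
      · exact hcross e he f hf
      · exact (hcross f hf e he).symm
      · exact (Set.disjoint_image_iff (glueMap_injective u w)).2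
          (hNd he hf fun h => hef (by rw [h]))
    · rintro ⟨M, N⟩ hp ⟨M', N'⟩ hp' h
      simp only [Finset.coe_filter, Finset.mem_product, mem_edgeMatchings hG,
        mem_edgeMatchings hK, Set.mem_ofPred_eq] at hp hp'
      have hN := hp.1.2.1
      have hN' := hp'.1.2.1
      simp only [Finset.ext_iff, Finset.mem_union, Finset.mem_map] at h
      have hl : ∀ e (A : Finset (Set α)) (B : Finset (Set β)), (B : Set (Set β)) ⊆ E(K) →
          (((∃ a ∈ A, F a = F e) ∨ ∃ b ∈ B, F' b = F e) ↔ e ∈ A) := by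
        intro e A B hB
        constructor
        · rintro (⟨a, ha, hae⟩ | ⟨b, hb, hbe⟩)
          · rwa [← F.injective hae]
          · exact absurd hbe.symm (hne e b (hB hb))
        · exact fun he => Or.inl ⟨e, he, rfl⟩
      have hrr : ∀ f (A : Finset (Set α)) (B : Finset (Set β)), (B : Set (Set β)) ⊆ E(K) →
          f ∈ E(K) → (((∃ a ∈ A, F a = F' f) ∨ ∃ b ∈ B, F' b = F' f) ↔ f ∈ B) := by
        intro f A B hB hf
        constructor
        · rintro (⟨a, ha, haf⟩ | ⟨b, hb, hbf⟩)
          · exact absurd haf (hne a f hf)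
          · rwa [← F'.injective hbf]
        · exact fun he => Or.inr ⟨f, he, rfl⟩
      refine Prod.ext (Finset.ext fun e => ?_) (Finset.ext fun f => ?_)
      · exact (hl e M N hN).symm.trans ((h (F e)).trans (hl e M' N' hN'))
      · by_cases hf : f ∈ E(K)
        · exact (hrr f M N hN hf).symm.trans ((h (F' f)).trans (hrr f M' N' hN' hf))
        · exact ⟨fun h => absurd (hN h) hf, fun h => absurd (hN' h) hf⟩
    · intro M hM
      rw [Finset.mem_coe, mem_edgeMatchings (finite_glue hG hK u w)] at hM
      obtain ⟨hME, hMd⟩ := hM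
      refine ⟨((finite_edgeSet hG).toFinset.filter (F · ∈ M),
        (finite_edgeSet hK).toFinset.filter (F' · ∈ M)), ?_, ?_⟩
      · simp only [Finset.coe_filter, Finset.mem_product, mem_edgeMatchings hG,
          mem_edgeMatchings hK, Set.mem_ofPred_eq, Finset.mem_filter, Set.Finite.mem_toFinset]
        refine ⟨⟨⟨fun e he => he.1, fun e he f hf hef => ?_⟩, fun e he => he.1,
          fun e he f hf hef => ?_⟩, ?_⟩
        · exact (Set.disjoint_image_iff Sum.inl_injective).1
            (hMd he.2 hf.2 (F.injective.ne hef))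
        · exact (Set.disjoint_image_iff (glueMap_injective u w)).1
            (hMd he.2 hf.2 (F'.injective.ne hef))
        · rintro ⟨⟨e, he, hue⟩, f, hf, hwf⟩
          exact disjoint_inl_glueMap.1 (hMd he.2 hf.2 (hne e f hf.1)) ⟨hue, hwf⟩
      · ext e
        simp only [Finset.mem_union, Finset.mem_map, Finset.mem_filter, Set.Finite.mem_toFinset]
        constructor
        · rintro (⟨a, ha, rfl⟩ | ⟨a, ha, rfl⟩)
          · exact ha.2
          · exact ha.2
        · intro he
          rcases hME he with ⟨a, ha, rfl⟩ | ⟨a, ha, rfl⟩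
          · exact Or.inl ⟨a, ⟨ha, he⟩, rfl⟩
          · exact Or.inr ⟨a, ⟨ha, he⟩, rfl⟩
    · rintro ⟨M, N⟩ hp
      simp only [Finset.mem_filter, Finset.mem_product, mem_edgeMatchings hG,
        mem_edgeMatchings hK] at hp
      rw [Finset.card_union_of_disjoint, Finset.card_map, Finset.card_map]
      rw [Finset.disjoint_left]
      intro e he he'
      obtain ⟨a, -, rfl⟩ := Finset.mem_map.1 he
      obtain ⟨b, hb, hab⟩ := Finset.mem_map.1 he'
      exact hne a b (hp.1.2.1 hb) hab.symm
  -- The difference enumerates the matchings of `K` that cover `w`; these pair only with matchings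
  -- of `G` avoiding `u`.
  have hsub : K.matchingGen - (K.deleteVertex w).matchingGen =
      ∑ N ∈ K.edgeMatchings, if ∃ f ∈ N, w ∈ f then X ^ N.card else 0 := by
    rw [matchingGen, matchingGen, edgeMatchings_deleteVertex hK, Finset.sum_filter,
      ← Finset.sum_sub_distrib]
    refine Finset.sum_congr rfl fun N _ => ?_
    by_cases h : ∃ f ∈ N, w ∈ f <;> simp only [h, not_true, not_false_iff, if_true, if_false] <;>
      ring
  rw [hpairs, hsub, matchingGen, matchingGen, matchingGen, edgeMatchings_deleteVertex hK,
    edgeMatchings_deleteVertex hG, Finset.sum_filter, Finset.sum_filter, Finset.sum_filter,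
    Finset.sum_mul_sum, Finset.sum_mul_sum, Finset.sum_product, ← Finset.sum_add_distrib]
  refine Finset.sum_congr rfl fun M _ => ?_
  rw [← Finset.sum_add_distrib]
  refine Finset.sum_congr rfl fun N _ => ?_
  by_cases h : ∃ e ∈ M, u ∈ e <;> by_cases h' : ∃ f ∈ N, w ∈ f <;>
    simp only [h, h', not_true, not_false_iff, if_true, if_false, and_true, and_false] <;> ring

/-- The matching polynomial of a coalescence depends on the first hypergraph only through its
order and the matching polynomials of it and of its vertex-deleted subhypergraph. -/
theorem matchingPoly_glue_eq {G : Hypergraph α} {H : Hypergraph β} {K : Hypergraph γ} {r : ℕ}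
    (hr : 1 < r) (hG : V(G).Finite) (hGr : G.IsUniform r) (hH : V(H).Finite)
    (hHr : H.IsUniform r) (hK : V(K).Finite) (hKr : K.IsUniform r)
    (hcard : V(G).ncard = V(H).ncard) {u : α} (hu : u ∈ V(G)) {v : β} (hv : v ∈ V(H))
    (hφ : G.matchingPoly r = H.matchingPoly r)
    (hφ' : (G.deleteVertex u).matchingPoly r = (H.deleteVertex v).matchingPoly r)
    {w : γ} (hw : w ∈ V(K)) :
    (G.glue u K w).matchingPoly r = (H.glue v K w).matchingPoly r := by
  have hr0 : 0 < r := by omega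
  -- Unlike the matching polynomial, the generating polynomial carries no vertex count in its
  -- exponents, so the gluing formula is stated for it.
  have h1 : G.matchingGen = H.matchingGen := (matchingGen_eq_iff hG hH).2
    (matchingCount_eq_of_matchingPoly_eq hr0 hG hH hGr hHr hcard hφ)
  have hcard' : V(G.deleteVertex u).ncard = V(H.deleteVertex v).ncard := by
    change (V(G) \ {u}).ncard = (V(H) \ {v}).ncard
    rw [Set.ncard_sdiff_singleton_of_mem hu, Set.ncard_sdiff_singleton_of_mem hv, hcard]
  have h2 : (G.deleteVertex u).matchingGen = (H.deleteVertex v).matchingGen :=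
    (matchingGen_eq_iff (finite_deleteVertex hG u) (finite_deleteVertex hH v)).2
      (matchingCount_eq_of_matchingPoly_eq hr0 (finite_deleteVertex hG u)
        (finite_deleteVertex hH v) (hGr.deleteVertex u) (hHr.deleteVertex v) hcard' hφ')
  have h3 : (G.glue u K w).matchingGen = (H.glue v K w).matchingGen := by
    rw [matchingGen_glue hr hG hK hKr, matchingGen_glue hr hH hK hKr, h1, h2]
  have h4 := (matchingGen_eq_iff (finite_glue hG hK u w) (finite_glue hH hK v w)).1 h3
  have h5 : V(G.glue u K w).ncard = V(H.glue v K w).ncard := by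
    have := ncard_vertexSet_glue hG hK hu hw
    have := ncard_vertexSet_glue hH hK hv hw
    omega
  simp only [matchingPoly, h4, h5]

end Hypergraph

theorem theorem3p2 {α β γ : Type*} (r : ℕ) (hr : 3 ≤ r)
    (G : Hypergraph α) (H : Hypergraph β) (K : Hypergraph γ)
    (hG : G.IsSupertree) (hGr : G.IsUniform r)
    (hH : H.IsSupertree) (hHr : H.IsUniform r)
    (hK : K.IsSupertree) (hKr : K.IsUniform r)
    (hcard : V(G).ncard = V(H).ncard)
    (u : α) (hu : u ∈ V(G)) (v : β) (hv : v ∈ V(H))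
    (hφ : G.matchingPoly r = H.matchingPoly r)
    (hφ' : (G.deleteVertex u).matchingPoly r = (H.deleteVertex v).matchingPoly r) :
    ∀ w ∈ V(K),
      ((G.glue u K w).IsSupertree ∧ (G.glue u K w).IsUniform r) ∧
      ((H.glue v K w).IsSupertree ∧ (H.glue v K w).IsUniform r) ∧
      (G.glue u K w).spectralRadius r = (H.glue v K w).spectralRadius r ∧
      (G.glue u K w).matchingEnergy r = (H.glue v K w).matchingEnergy r := by
  intro w hw
  have hr1 : 1 < r := by omega
  have hr0 : 0 < r := by omega
  have hGT := hG.glue hr1 hGr hK hKr hu hw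
  have hHT := hH.glue hr1 hHr hK hKr hv hw
  have hGU := hGr.glue hKr u w
  have hHU := hHr.glue hKr v w
  have hpoly := Hypergraph.matchingPoly_glue_eq hr1 hG.finite hGr hH.finite hHr hK.finite hKr hcard hu hv
    hφ hφ' hw
  refine ⟨⟨hGT, hGU⟩, ⟨hHT, hHU⟩, ?_, by rw [Hypergraph.matchingEnergy, Hypergraph.matchingEnergy, hpoly]⟩
  have h := hGT.isGreatest_roots hr0 hGU
  rw [hpoly] at h
  exact h.unique (hHT.isGreatest_roots hr0 hHU)
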